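/- For a subset $A$ of a finite abelian group $G$ (written additively) let $\Sigma(A)=\{\sum_{a\in B}a : B\subseteq A\}$ (so the empty sum $0$ belongs to $\Sigma(A)$), and for $S\subseteq G$ let the stabiliser of $S$ be the subgroup $\{g\in G : g+S=S\}$. There is a function $\varepsilon:\mathbb{R}\to\mathbb{R}$ with $\varepsilon(x)\to 0$ as $x\to\infty$ such that, for every finite abelian group $G$ and every subset $A\subseteq G$, if $H$ denotes the stabiliser of $\Sigma(A)$, then $$|\Sigma(A)|\ \ge\ \Bigl(\tfrac14-\varepsilon\bigl(|A\setminus H|/|H|\bigr)\Bigr)\,|A\setminus H|^{2}.$$ -/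

import Mathlib

open Filter
open scoped Pointwise Topology

/-! Passing to `G ⧸ H` turns `A \ H` into a family of `n` nonzero elements, each repeated at most `m
= |H|` times, with no nontrivial subgroup `K` filled by the sums of the members lying in `K`. Since
`Σ(A)` is a union of `H`-cosets, it suffices to show that such an admissible family has about `n² /
(4m)` subset sums.

Subset sums are built greedily: with `U` already used and `V` remaining, some `v ∈ V` enlarges `sums
a U` by nearly `|V| / (2m)`. Summing over `|V|` from `n` down to `0` gives `n² / (4m)`. The
increment comes from two facts. By an isoperimetric inequality for atoms
(`exists_subgroup_min_boundary`), adding `S = {0} ∪ ±a(V)` to a set gains about `κ = |V| / m`,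
unless everything is reached or some subgroup obstructs. An averaging argument
(`half_bound_le_of_shiftDefect_le`) turns this into a translate by a single element of `S` that
gains about `κ / 2`.

Two obstructions remain. If much of `V` lies in a subgroup `K`, a weaker quadratic bound
(`Admissible.sq_card_le`) makes `K` itself large, which is harmless. If `sums a U` nearly fills a
coset of the group generated by `V`, then `U ∪ V` fills that coset, and a small reserve `R` set
aside beforehand (`exists_reserve`) reaches all other cosets, contradicting admissibility. A reserve
exists once no subgroup omits only a few elements of the family; `exists_robust_subset` arranges
this at the cost of few elements. -/

namespace SubsetSums

variable {G : Type*} [AddCommGroup G]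

/-! ### Isoperimetry: atoms of a symmetric set. -/

section Isoperimetry

variable [Finite G]

/-- An isoperimetric inequality: the sets with the smallest boundary with respect to a symmetric
set `S` include a subgroup. -/
theorem exists_subgroup_min_boundary {S : Set G} (h0 : (0 : G) ∈ S) (hneg : -S = S)
    (hS : S ≠ Set.univ) :
    ∃ H : AddSubgroup G, (H : Set G) + S ≠ Set.univ ∧
      ∀ X : Set G, X.Nonempty → X + S ≠ Set.univ →
        ((H : Set G) + S).ncard + X.ncard ≤ (X + S).ncard + (H : Set G).ncard := by
  classical
  -- Here `k` is the least growth `|X + S| - |X|`, and `c` the least size of a set attaining it.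
  -- Such minimal sets are the atoms.
  let P : ℕ → Prop := fun k => ∃ X : Set G, X.Nonempty ∧ X + S ≠ Set.univ ∧
    (X + S).ncard = X.ncard + k
  have hle : ∀ X : Set G, X.ncard ≤ (X + S).ncard := fun X =>
    Set.ncard_le_ncard (fun x hx => ⟨x, hx, 0, h0, add_zero x⟩)
  have hP : ∃ k, P k := ⟨({0} + S).ncard - ({0} : Set G).ncard, {0}, by simp, by simpa using hS, by
    have := hle {0}; omega⟩
  let k := Nat.find hP
  have hk : ∀ X : Set G, X.Nonempty → X + S ≠ Set.univ → X.ncard + k ≤ (X + S).ncard := by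
    intro X hX hXS
    have h1 := hle X
    have : k ≤ (X + S).ncard - X.ncard := Nat.find_min' hP ⟨X, hX, hXS, by omega⟩
    omega
  let Q : ℕ → Prop := fun c => ∃ X : Set G, X.Nonempty ∧ X + S ≠ Set.univ ∧
    (X + S).ncard = X.ncard + k ∧ X.ncard = c
  have hQ : ∃ c, Q c := by
    obtain ⟨X, h1, h2, h3⟩ := Nat.find_spec hP
    exact ⟨_, X, h1, h2, h3, rfl⟩
  let c := Nat.find hQ
  have hc : ∀ X : Set G, X.Nonempty → X + S ≠ Set.univ → (X + S).ncard ≤ X.ncard + k →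
      c ≤ X.ncard := fun X h1 h2 h3 =>
    Nat.find_min' hQ ⟨X, h1, h2, le_antisymm h3 (hk X h1 h2), rfl⟩
  -- By symmetry of `S`, the set `(X + S)ᶜ + S` misses `X`, so `(X + S)ᶜ` also has growth at most
  -- `k`.
  have hcompl : ∀ X : Set G, X.Nonempty → X + S ≠ Set.univ → (X + S).ncard = X.ncard + k →
      c ≤ (X + S)ᶜ.ncard := by
    intro X h1 h2 h3
    have hdisj : (X + S)ᶜ + S ⊆ Xᶜ := by
      rintro _ ⟨y, hy, s, hs, rfl⟩ hx
      apply hy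
      refine ⟨y + s, hx, -s, ?_, by simp⟩
      rw [← hneg]; simpa using hs
    have e1 := Set.ncard_add_ncard_compl (X + S)
    have e2 := Set.ncard_add_ncard_compl X
    have e3 := Set.ncard_le_ncard hdisj
    refine hc _ (Set.nonempty_compl.2 h2) ?_ (by omega)
    intro h
    obtain ⟨x, hx⟩ := h1
    exact hdisj (h ▸ Set.mem_univ x) hx
  -- Growth is submodular, so the intersection of two meeting atoms has growth at most `k`;
  -- minimality of `c` then makes the atoms equal.
  have hinter : ∀ X Y : Set G, X + S ≠ Set.univ → (X + S).ncard = X.ncard + k →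
      X.ncard = c → Y + S ≠ Set.univ → (Y + S).ncard = Y.ncard + k → Y.ncard = c →
      (X ∩ Y).Nonempty → X = Y := by
    intro X Y hX1 hX2 hX3 hY1 hY2 hY3 hne
    have hsub : (X ∩ Y) + S ⊆ (X + S) ∩ (Y + S) := Set.inter_add_subset
    have hne' : (X ∩ Y) + S ≠ Set.univ := by
      intro h
      apply hX1
      exact Set.eq_univ_of_univ_subset (h ▸ hsub.trans Set.inter_subset_left)
    have e1 := Set.ncard_le_ncard hsub
    have e2 := Set.ncard_union_add_ncard_inter (X + S) (Y + S)
    have e3 := Set.ncard_union_add_ncard_inter X Y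
    have hu : (X ∪ Y) + S = (X + S) ∪ (Y + S) := Set.union_add
    have hpos : 0 < (X ∩ Y).ncard := (Set.ncard_pos).2 hne
    have e4 := hk _ hne hne'
    have hsmall : ((X ∩ Y) + S).ncard ≤ (X ∩ Y).ncard + k := by
      -- If the union already spreads to everything, minimality of `k` says nothing about it; the
      -- size of `(X + S)ᶜ` is used instead.
      by_cases hun : (X ∪ Y) + S = Set.univ
      · have e5 := hcompl X (hne.mono Set.inter_subset_left) hX1 hX2
        have e6 := Set.ncard_add_ncard_compl (X + S)
        have e7 : ((X + S) ∪ (Y + S)).ncard = Nat.card G := by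
          rw [← hu, hun, Set.ncard_univ]
        omega
      · have e5 := hk _ (hne.mono (Set.inter_subset_left.trans Set.subset_union_left)) hun
        rw [hu] at e5
        omega
    have e8 := hc _ hne hne' hsmall
    have hXY : X ∩ Y = X := Set.eq_of_subset_of_ncard_le Set.inter_subset_left (by omega)
    have hYX : X ∩ Y = Y := Set.eq_of_subset_of_ncard_le Set.inter_subset_right (by omega)
    rw [← hXY, hYX]
  -- Translates of atoms are atoms, so distinct ones are disjoint, and the one through `0` is a
  -- subgroup.
  obtain ⟨X, hX0, hX1, hX2, hX3⟩ := Nat.find_spec hQ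
  have htrans : ∀ x : G, (x +ᵥ X) + S ≠ Set.univ ∧ ((x +ᵥ X) + S).ncard = (x +ᵥ X).ncard + k ∧
      (x +ᵥ X).ncard = c := by
    intro x
    have h1 : (x +ᵥ X) + S = x +ᵥ (X + S) := vadd_add_assoc x X S
    refine ⟨?_, ?_, ?_⟩
    · intro h
      rw [h1] at h
      apply hX1
      have : -x +ᵥ (x +ᵥ (X + S)) = -x +ᵥ (Set.univ : Set G) := by rw [h]
      simpa using this
    · rw [h1, Set.ncard_vadd_set, Set.ncard_vadd_set, hX2]
    · rw [Set.ncard_vadd_set, hX3]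
  obtain ⟨x₀, hx₀⟩ := hX0
  let Y : Set G := -x₀ +ᵥ X
  have hY0 : (0 : G) ∈ Y := ⟨x₀, hx₀, by simp⟩
  obtain ⟨hY1, hY2, hY3⟩ := htrans (-x₀)
  have hYsub : ∀ y ∈ Y, -y +ᵥ Y = Y := by
    intro y hy
    have := htrans (-y + -x₀)
    rw [add_vadd] at this
    obtain ⟨h1, h2, h3⟩ := this
    exact hinter _ _ h1 h2 h3 hY1 hY2 hY3 ⟨0, ⟨y, hy, by simp⟩, hY0⟩
  have hYneg : ∀ y ∈ Y, -y ∈ Y := by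
    intro y hy
    rw [← hYsub y hy]
    exact ⟨0, hY0, by simp⟩
  refine ⟨{ carrier := Y, zero_mem' := hY0, neg_mem' := fun {y} hy => hYneg y hy,
            add_mem' := ?_ }, hY1, ?_⟩
  · intro y z hy hz
    have := hYsub _ (hYneg y hy)
    rw [← this]
    exact ⟨z, hz, by simp⟩
  · intro Z hZ hZS
    have := hk Z hZ hZS
    change (Y + S).ncard + Z.ncard ≤ (Z + S).ncard + Y.ncard
    have : (Y + S).ncard = Y.ncard + k := hY2
    omega

/-- Only the minimising subgroup `H` has to be tested: outside `H`, the set `H + S` contains both `S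
\ H` and a full coset of `H`. -/
theorem add_ncard_le_ncard_add {S : Set G} (h0 : (0 : G) ∈ S) (hneg : -S = S) {κ : ℝ}
    (hgen : ∀ H : AddSubgroup G, S ⊆ H → H = ⊤)
    (hκ : ∀ H : AddSubgroup G, H ≠ ⊤ → κ ≤ ((S \ H).ncard : ℝ) ∨ κ ≤ ((H : Set G).ncard : ℝ))
    {X : Set G} (hX : X.Nonempty) (hXS : X + S ≠ Set.univ) :
    (X.ncard : ℝ) + κ ≤ ((X + S).ncard : ℝ) := by
  have hS : S ≠ Set.univ := by
    rintro rfl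
    apply hXS
    obtain ⟨x, hx⟩ := hX
    exact Set.eq_univ_of_forall fun y => ⟨x, hx, y - x, Set.mem_univ _, by simp⟩
  obtain ⟨H, hH1, hH2⟩ := exists_subgroup_min_boundary h0 hneg hS
  have hHtop : H ≠ ⊤ := by
    rintro rfl
    apply hH1
    exact Set.eq_univ_of_forall fun y => ⟨y, by simp, 0, h0, by simp⟩
  have key := hH2 X hX hXS
  have hmain : (κ : ℝ) + (H : Set G).ncard ≤ (((H : Set G) + S).ncard : ℝ) := by
    have hHS : (H : Set G) ⊆ H + S := fun x hx => ⟨x, hx, 0, h0, by simp⟩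
    rcases hκ H hHtop with h | h
    · have hsub : (S \ H) ∪ (H : Set G) ⊆ H + S := by
        refine Set.union_subset (fun s hs => ⟨0, H.zero_mem, s, hs.1, by simp⟩) hHS
      have e1 := Set.ncard_le_ncard hsub
      rw [Set.ncard_union_eq Set.disjoint_sdiff_left] at e1
      have : (((S \ H).ncard : ℝ) + ((H : Set G).ncard : ℝ)) ≤ (((H : Set G) + S).ncard : ℝ) := by
        exact_mod_cast e1
      linarith
    · obtain ⟨s, hs, hsH⟩ : ∃ s ∈ S, s ∉ H := by
        by_contra! hcon
        exact hHtop (hgen H hcon)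
      have hsub : (s +ᵥ (H : Set G)) ∪ (H : Set G) ⊆ H + S := by
        refine Set.union_subset ?_ hHS
        rintro _ ⟨x, hx, rfl⟩
        exact ⟨x, hx, s, hs, by simp [add_comm]⟩
      have hdisj : Disjoint (s +ᵥ (H : Set G)) (H : Set G) := by
        rw [Set.disjoint_left]
        rintro _ ⟨x, hx, rfl⟩ h2
        apply hsH
        have := H.sub_mem h2 hx
        simpa using this
      have e1 := Set.ncard_le_ncard hsub
      rw [Set.ncard_union_eq hdisj, Set.ncard_vadd_set] at e1
      have : (((H : Set G).ncard : ℝ) + ((H : Set G).ncard : ℝ)) ≤ (((H : Set G) + S).ncard : ℝ) := by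
        exact_mod_cast e1
      linarith
  have key' : ((((H : Set G) + S).ncard : ℝ) + X.ncard) ≤ (X + S).ncard + (H : Set G).ncard := by
    exact_mod_cast key
  linarith

end Isoperimetry

/-! ### Iterated sumsets, shift defects and the averaging argument. -/

/-- The `n`-fold sumset of `S`. -/
def multiple (S : Set G) : ℕ → Set G
  | 0 => {0}
  | n + 1 => multiple S n + S

theorem multiple_mono {S : Set G} (h0 : (0 : G) ∈ S) : Monotone (multiple S) :=
  monotone_nat_of_le_succ fun _ x hx => ⟨x, hx, 0, h0, add_zero x⟩

theorem min_le_ncard_multiple [Finite G] {S : Set G} (h0 : (0 : G) ∈ S) {κ : ℝ}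
    (hS : ∀ X : Set G, X.Nonempty → X + S ≠ Set.univ → (X.ncard : ℝ) + κ ≤ (X + S).ncard) (n : ℕ) :
    min (Nat.card G : ℝ) (n * κ) ≤ (multiple S n).ncard := by
  induction n with
  | zero => simp [multiple]
  | succ n ih =>
    by_cases h : multiple S (n + 1) = Set.univ
    · rw [h, Set.ncard_univ]; exact min_le_left _ _
    · have hne : (multiple S n).Nonempty := ⟨0, multiple_mono h0 (Nat.zero_le n) rfl⟩
      have h1 := hS _ hne h
      have h2 : ((multiple S n).ncard : ℝ) ≤ (multiple S (n + 1)).ncard := by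
        exact_mod_cast Set.ncard_le_ncard (multiple_mono h0 (Nat.le_succ n))
      change _ ≤ ((multiple S n + S).ncard : ℝ)
      change _ ≤ ((multiple S n + S).ncard : ℝ) at h2
      rcases min_le_iff.1 ih with h3 | h3
      · exact (min_le_left _ _).trans (h3.trans h2)
      · refine (min_le_right _ _).trans ?_
        push_cast
        linarith

/-- The number of elements that a translate of `B` has outside `B`. -/
noncomputable def shiftDefect (B : Set G) (g : G) : ℕ := ((g +ᵥ B) \ B).ncard

theorem shiftDefect_zero (B : Set G) : shiftDefect B 0 = 0 := by
  simp [shiftDefect]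

section ShiftDefect

variable [Finite G]

theorem shiftDefect_add_ncard_inter (B : Set G) (g : G) :
    shiftDefect B g + ((g +ᵥ B) ∩ B).ncard = B.ncard := by
  rw [shiftDefect, add_comm, Set.ncard_inter_add_ncard_sdiff_eq_ncard, Set.ncard_vadd_set]

theorem shiftDefect_neg (B : Set G) (g : G) : shiftDefect B (-g) = shiftDefect B g := by
  have h1 := shiftDefect_add_ncard_inter B g
  have h2 := shiftDefect_add_ncard_inter B (-g)
  have h3 : g +ᵥ ((-g +ᵥ B) ∩ B) = (g +ᵥ B) ∩ B := by
    rw [Set.vadd_set_inter, vadd_neg_vadd, Set.inter_comm]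
  have h4 := Set.ncard_vadd_set g ((-g +ᵥ B) ∩ B)
  rw [h3] at h4
  omega

theorem shiftDefect_add_le (B : Set G) (g h : G) :
    shiftDefect B (g + h) ≤ shiftDefect B g + shiftDefect B h := by
  have hsub : ((g + h) +ᵥ B) \ B ⊆ (g +ᵥ ((h +ᵥ B) \ B)) ∪ ((g +ᵥ B) \ B) := by
    rintro x ⟨hx1, hx2⟩
    by_cases hx : x ∈ g +ᵥ B
    · exact Or.inr ⟨hx, hx2⟩
    · refine Or.inl ?_
      rw [Set.vadd_set_sdiff, ← add_vadd]
      exact ⟨hx1, hx⟩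
  have := (Set.ncard_le_ncard hsub).trans (Set.ncard_union_le _ _)
  rw [Set.ncard_vadd_set] at this
  rw [shiftDefect, shiftDefect, shiftDefect]
  omega

theorem shiftDefect_compl (B : Set G) (g : G) : shiftDefect Bᶜ g = shiftDefect B g := by
  rw [← shiftDefect_neg B g]
  have h : (g +ᵥ Bᶜ) \ Bᶜ = g +ᵥ ((-g +ᵥ B) \ B) := by
    rw [Set.vadd_set_sdiff, vadd_neg_vadd, Set.vadd_set_compl]
    ext x; simp [and_comm]
  rw [shiftDefect, shiftDefect, h, Set.ncard_vadd_set]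

theorem shiftDefect_multiple_le {B S : Set G} {l : ℝ} (hl : ∀ s ∈ S, (shiftDefect B s : ℝ) ≤ l)
    (n : ℕ) {g : G} (hg : g ∈ multiple S n) : (shiftDefect B g : ℝ) ≤ n * l := by
  induction n generalizing g with
  | zero =>
    obtain rfl : g = 0 := hg
    simp [shiftDefect_zero]
  | succ n ih =>
    obtain ⟨x, hx, s, hs, rfl⟩ := hg
    have h1 : (shiftDefect B (x + s) : ℝ) ≤ shiftDefect B x + shiftDefect B s := by
      exact_mod_cast shiftDefect_add_le B x s
    push_cast
    linarith [ih hx, hl s hs]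

end ShiftDefect

theorem sum_ncard_inter [Fintype G] (B : Set G) :
    ∑ g : G, ((g +ᵥ B) ∩ B).ncard = B.ncard ^ 2 := by
  classical
  have h1 : ∀ g : G, ((g +ᵥ B) ∩ B).ncard =
      ∑ x ∈ B.toFinset, if x - g ∈ B then 1 else 0 := by
    intro g
    rw [← Finset.sum_filter, Finset.sum_const, smul_eq_mul, mul_one, ← Set.ncard_coe_finset]
    congr 1
    ext x
    simp only [Set.mem_inter_iff, Set.mem_vadd_set_iff_neg_vadd_mem, vadd_eq_add, Finset.coe_filter,
      Set.mem_toFinset, Set.mem_ofPred_eq]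
    rw [and_comm, neg_add_eq_sub]
  simp_rw [h1]
  rw [Finset.sum_comm]
  have h2 : ∀ x : G, (∑ g : G, if x - g ∈ B then 1 else 0) = B.ncard := by
    intro x
    have h3 := (Equiv.subLeft x).sum_comp (fun y => if y ∈ B then 1 else 0)
    simp only [Equiv.subLeft_apply] at h3
    rw [h3, ← Finset.sum_filter,
      Finset.sum_const, smul_eq_mul, mul_one, ← Set.ncard_coe_finset]
    congr 1
    ext; simp
  simp_rw [h2]
  rw [Finset.sum_const, smul_eq_mul, ← Set.ncard_eq_toFinset_card', sq]

/-- With `x = Jκ` the hypothesis reads `l ≥ 2κb(x - b) / (x(x + κ))`. As `(x - b) / x²` peaks at `x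
= 2b`, with value `1 / (4b)`, the choice `J ≈ 2b / κ` yields nearly `κ / 2`. -/
theorem half_bound_of_quadratic {κ b l J : ℝ} (hκ : 0 < κ) (hκb : κ ≤ b) (hl : 0 ≤ l)
    (hJ1 : J * κ ≤ 2 * b) (hJ2 : 2 * b < (J + 1) * κ)
    (h : (b - J * l) * (J * κ) + l * (κ * (J * (J - 1) / 2)) ≤ b ^ 2) :
    κ / 2 * (1 - κ / b) ≤ l := by
  have hb : 0 < b := hκ.trans_le hκb
  set x := J * κ with hx
  have hxlow : 2 * b - κ < x := by linarith
  have hxpos : 0 < x := by linarith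
  have h1 : 2 * κ * b * (x - b) ≤ l * (x * (x + κ)) := by
    have : κ * ((b - J * l) * x + l * (κ * (J * (J - 1) / 2))) ≤ κ * b ^ 2 :=
      mul_le_mul_of_nonneg_left h hκ.le
    have e : κ * ((b - J * l) * x + l * (κ * (J * (J - 1) / 2))) =
        κ * b * x - l * (x * (x + κ)) / 2 := by rw [hx]; ring
    rw [e] at this
    linarith
  have h2 : l * (x * (x + κ)) ≤ l * (x * (2 * b + κ)) :=
    mul_le_mul_of_nonneg_left (mul_le_mul_of_nonneg_left (by linarith) hxpos.le) hl
  have h3 : x * (b - κ) ≤ (2 * b - κ) * (x - b) := by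
    nlinarith
  have h4 : κ * (b - κ) ≤ l * (2 * b) := by
    have h5 : 2 * κ * b * (x * (b - κ)) ≤ (2 * b - κ) * (l * (x * (2 * b + κ))) := by
      calc 2 * κ * b * (x * (b - κ)) ≤ 2 * κ * b * ((2 * b - κ) * (x - b)) :=
            mul_le_mul_of_nonneg_left h3 (by positivity)
        _ = (2 * b - κ) * (2 * κ * b * (x - b)) := by ring
        _ ≤ (2 * b - κ) * (l * (x * (2 * b + κ))) :=
            mul_le_mul_of_nonneg_left (h1.trans h2) (by linarith)
    have h6 : 2 * κ * b * (b - κ) ≤ (2 * b - κ) * (2 * b + κ) * l := by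
      refine le_of_mul_le_mul_left ?_ hxpos
      calc x * (2 * κ * b * (b - κ)) = 2 * κ * b * (x * (b - κ)) := by ring
        _ ≤ _ := h5
        _ = _ := by ring
    have h7 : (2 * b - κ) * (2 * b + κ) * l ≤ 4 * b ^ 2 * l := by
      apply mul_le_mul_of_nonneg_right _ hl
      nlinarith [sq_nonneg κ]
    refine le_of_mul_le_mul_left ?_ (show (0:ℝ) < 2 * b by positivity)
    calc 2 * b * (κ * (b - κ)) = 2 * κ * b * (b - κ) := by ring
      _ ≤ _ := h6.trans h7
      _ = _ := by ring
  have e : κ / 2 * (1 - κ / b) = κ * (b - κ) / (2 * b) := by field_simp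
  rw [e, div_le_iff₀ (by positivity)]
  exact h4

/-- If every proper translate-sum with `S` grows by at least `κ`, then some element of `S` moves
`B` by roughly `κ / 2`. -/
theorem half_bound_le_of_shiftDefect_le [Finite G] {S B : Set G} (h0 : (0 : G) ∈ S) {κ l : ℝ}
    (hκ : 0 < κ)
    (hS : ∀ X : Set G, X.Nonempty → X + S ≠ Set.univ → (X.ncard : ℝ) + κ ≤ (X + S).ncard)
    (hκB : κ ≤ B.ncard) (hB : 2 * B.ncard ≤ Nat.card G)
    (hl : ∀ s ∈ S, (shiftDefect B s : ℝ) ≤ l) :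
    κ / 2 * (1 - κ / B.ncard) ≤ l := by
  classical
  cases nonempty_fintype G
  set b : ℝ := (B.ncard : ℝ) with hb
  have hbpos : 0 < b := hκ.trans_le hκB
  have hl0 : 0 ≤ l := (Nat.cast_nonneg _).trans (hl 0 h0)
  by_cases hlκ : κ / 2 ≤ l
  · refine le_trans ?_ hlκ
    have : 0 ≤ κ / b := by positivity
    nlinarith
  push Not at hlκ
  set J := ⌊2 * b / κ⌋₊ with hJ
  have hJ1 : (J : ℝ) * κ ≤ 2 * b := by
    rw [← le_div_iff₀ hκ]; exact Nat.floor_le (by positivity)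
  have hJ2 : 2 * b < ((J : ℝ) + 1) * κ := by
    rw [← div_lt_iff₀ hκ]; exact Nat.lt_floor_add_one _
  have hJl : (J : ℝ) * l ≤ b := by nlinarith [Nat.cast_nonneg (α := ℝ) J]
  have hcard : ∀ i ≤ J, (i : ℝ) * κ ≤ (multiple S i).ncard := by
    intro i hi
    refine le_trans (le_min ?_ le_rfl) (min_le_ncard_multiple h0 hS i)
    have h1 : (i : ℝ) * κ ≤ J * κ := by gcongr
    have h2 : 2 * b ≤ Nat.card G := by rw [hb]; exact_mod_cast hB
    linarith
  have hmono := multiple_mono h0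
  -- If `g` first appears in the `i₀`-fold sumset, subadditivity gives an intersection of size at
  -- least `b - i₀l = (b - Jl) + l(J - i₀)`, and `J - i₀` counts the `i < J` whose sumset contains
  -- `g`. Summing over `g` and comparing with `b²` brings in the sizes `|iS| ≥ iκ`.
  have hpt : ∀ g : G, (b - J * l) * (if g ∈ multiple S J then 1 else 0) +
      l * ∑ i ∈ Finset.range J, (if g ∈ multiple S i then (1 : ℝ) else 0) ≤
      (((g +ᵥ B) ∩ B).ncard : ℝ) := by
    intro g
    by_cases hg : g ∈ multiple S J
    · have hex : ∃ i, g ∈ multiple S i := ⟨J, hg⟩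
      set i₀ := Nat.find hex with hi₀
      have hi₀J : i₀ ≤ J := Nat.find_min' hex hg
      have h1 := shiftDefect_multiple_le hl i₀ (Nat.find_spec hex)
      have h2 : (shiftDefect B g : ℝ) + ((g +ᵥ B) ∩ B).ncard = b := by
        rw [hb]; exact_mod_cast shiftDefect_add_ncard_inter B g
      have h3 : ∑ i ∈ Finset.range J, (if g ∈ multiple S i then (1 : ℝ) else 0) ≤ J - i₀ := by
        rw [Finset.sum_ite, Finset.sum_const_zero, add_zero, Finset.sum_const, nsmul_eq_mul,
          mul_one]
        have : (Finset.range J).filter (fun i => g ∈ multiple S i) ⊆ Finset.Ico i₀ J := by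
          intro i hi
          rw [Finset.mem_filter, Finset.mem_range] at hi
          exact Finset.mem_Ico.2 ⟨Nat.find_min' hex hi.2, hi.1⟩
        have h4 := Finset.card_le_card this
        rw [Nat.card_Ico] at h4
        rw [← Nat.cast_sub hi₀J]
        exact_mod_cast h4
      have h5 := mul_le_mul_of_nonneg_left h3 hl0
      rw [if_pos hg]
      linarith
    · have h1 : ∀ i ∈ Finset.range J, (if g ∈ multiple S i then (1 : ℝ) else 0) = 0 := by
        intro i hi
        rw [if_neg]
        exact fun h => hg (hmono (Finset.mem_range.1 hi).le h)
      rw [if_neg hg, Finset.sum_eq_zero h1]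
      simp
  have hind : ∀ i, ∑ g : G, (if g ∈ multiple S i then (1 : ℝ) else 0) = (multiple S i).ncard := by
    intro i
    rw [Finset.sum_ite, Finset.sum_const_zero, add_zero, Finset.sum_const, nsmul_eq_mul,
      mul_one, ← Set.ncard_coe_finset]
    congr 2
    ext; simp
  have hsum := Finset.sum_le_sum fun g (_ : g ∈ Finset.univ) => hpt g
  have hsq : ∑ g : G, (((g +ᵥ B) ∩ B).ncard : ℝ) = b ^ 2 := by
    rw [hb]; exact_mod_cast sum_ncard_inter B
  rw [hsq, Finset.sum_add_distrib, ← Finset.mul_sum, ← Finset.mul_sum, Finset.sum_comm, hind] at hsum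
  simp_rw [hind] at hsum
  refine half_bound_of_quadratic hκ hκB hl0 hJ1 hJ2 (le_trans ?_ hsum)
  have hgauss : ∑ i ∈ Finset.range J, (i : ℝ) * κ = κ * ((J : ℝ) * (J - 1) / 2) := by
    rw [← Finset.sum_mul]
    have : ∀ n : ℕ, ∑ i ∈ Finset.range n, (i : ℝ) = (n : ℝ) * (n - 1) / 2 := by
      intro n
      induction n with
      | zero => simp
      | succ n ih => rw [Finset.sum_range_succ, ih]; push_cast; ring
    rw [this]; ring
  rw [← hgauss]
  refine add_le_add (mul_le_mul_of_nonneg_left (hcard J le_rfl) (by linarith)) ?_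
  exact mul_le_mul_of_nonneg_left
    (Finset.sum_le_sum fun i hi => hcard i (Finset.mem_range.1 hi).le) hl0

/-! ### Indexed families: a large shift by some member. -/

variable {ι : Type*}

/-- The set of sums of `a` over subsets of `I`. -/
def sums (a : ι → G) (I : Finset ι) : Set G := {g | ∃ J ⊆ I, ∑ i ∈ J, a i = g}

open Classical in
/-- The indices in `I` whose values lie in `K`. -/
noncomputable def within (a : ι → G) (I : Finset ι) (K : AddSubgroup G) : Finset ι :=
  I.filter fun i => a i ∈ K

open Classical in
/-- The indices in `I` whose values lie outside `K`. -/
noncomputable def outside (a : ι → G) (I : Finset ι) (K : AddSubgroup G) : Finset ι :=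
  I.filter fun i => a i ∉ K

theorem mem_within {a : ι → G} {I : Finset ι} {K : AddSubgroup G} {i : ι} :
    i ∈ within a I K ↔ i ∈ I ∧ a i ∈ K := by
  simp [within]

theorem mem_outside {a : ι → G} {I : Finset ι} {K : AddSubgroup G} {i : ι} :
    i ∈ outside a I K ↔ i ∈ I ∧ a i ∉ K := by
  simp [outside]

theorem card_within_add_card_outside (a : ι → G) (I : Finset ι) (K : AddSubgroup G) :
    (within a I K).card + (outside a I K).card = I.card := by
  classical
  simpa [within, outside] using Finset.card_filter_add_card_filter_not (s := I) (fun i => a i ∈ K)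

/-- Every value is taken by `a` at most `m` times on `I`. -/
def MultiplicityLE {α : Type*} (a : ι → α) (I : Finset ι) (m : ℕ) : Prop :=
  ∀ J ⊆ I, ∀ g, (∀ j ∈ J, a j = g) → J.card ≤ m

theorem MultiplicityLE.card_le {α : Type*} [Finite α] {a : ι → α} {I : Finset ι} {m : ℕ}
    (h : MultiplicityLE a I m) : I.card ≤ m * (a '' I).ncard := by
  classical
  have h1 := Finset.card_le_mul_card_image (f := a) I m (fun g _ =>
    h _ (Finset.filter_subset _ _) g (fun j hj => (Finset.mem_filter.1 hj).2))
  rwa [← Set.ncard_coe_finset (I.image a), Finset.coe_image] at h1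

theorem MultiplicityLE.mono {α : Type*} {a : ι → α} {I J : Finset ι} {m : ℕ}
    (h : MultiplicityLE a I m) (hJ : J ⊆ I) : MultiplicityLE a J m :=
  fun K hK => h K (hK.trans hJ)

/-- The averaging bound is applied to `{0} ∪ ±a(V)`, where neither `0` nor signs affect the maximal
defect. The factor `m` passes from indices to distinct values. A set filling more than half the
group is replaced by its complement, which has the same defects. -/
theorem exists_half_bound_le_shiftDefect_of_closure_eq_top [Finite G] {a : ι → G} {V : Finset ι}
    {m : ℕ} (hm : MultiplicityLE a V m) (hV : AddSubgroup.closure (a '' V) = ⊤) {κ T : ℝ}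
    (hκ : 0 < κ) (hκT : κ ≤ T)
    (hgen : ∀ K : AddSubgroup G, K ≠ ⊤ → κ * m ≤ (outside a V K).card ∨ κ ≤ Nat.card K)
    {B : Set G} (hB1 : T ≤ B.ncard) (hB2 : B.ncard + T ≤ Nat.card G) :
    ∃ v ∈ V, κ / 2 * (1 - κ / T) ≤ shiftDefect B (a v) := by
  have hT : 0 < T := hκ.trans_le hκT
  have hVne : V.Nonempty := by
    rw [Finset.nonempty_iff_ne_empty]
    rintro rfl
    simp only [Finset.coe_empty, Set.image_empty, AddSubgroup.closure_empty] at hV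
    have h1 : Nat.card G = 1 := by
      have := congrArg (fun K : AddSubgroup G => Nat.card K) hV
      simp only [AddSubgroup.card_bot, AddSubgroup.card_top] at this
      exact this.symm
    have h2 : (0 : ℝ) < B.ncard := hT.trans_le hB1
    have h3 : (1 : ℝ) ≤ B.ncard := by
      have : 0 < B.ncard := by exact_mod_cast h2
      exact_mod_cast this
    rw [h1] at hB2
    push_cast at hB2
    linarith
  obtain ⟨v, hv, hmax⟩ := Finset.exists_max_image V (fun v => shiftDefect B (a v)) hVne
  refine ⟨v, hv, ?_⟩
  set S : Set G := {0} ∪ (a '' V ∪ -(a '' V)) with hSdef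
  have h0 : (0 : G) ∈ S := Or.inl rfl
  have hneg : -S = S := by
    rw [hSdef, Set.union_neg, Set.union_neg, neg_neg, Set.union_comm (-(a '' V))]
    simp
  have haS : a '' V ⊆ S := fun x hx => Or.inr (Or.inl hx)
  have hl : ∀ s ∈ S, (shiftDefect B s : ℝ) ≤ shiftDefect B (a v) := by
    rintro s (rfl | ⟨i, hi, rfl⟩ | ⟨i, hi, hi'⟩)
    · rw [shiftDefect_zero]; simp
    · exact_mod_cast hmax i hi
    · rw [← shiftDefect_neg, ← hi']; exact_mod_cast hmax i hi
  have hS : ∀ X : Set G, X.Nonempty → X + S ≠ Set.univ → (X.ncard : ℝ) + κ ≤ (X + S).ncard := by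
    intro X hX hXS
    refine add_ncard_le_ncard_add h0 hneg (fun H hH => ?_) (fun H hH => ?_) hX hXS
    · rw [eq_top_iff, ← hV, AddSubgroup.closure_le]
      exact haS.trans hH
    · rcases hgen H hH with h | h
      · left
        have h1 := (hm.mono (J := outside a V H) (fun i hi => (mem_outside.1 hi).1)).card_le
        have hsub : a '' (outside a V H) ⊆ S \ H := by
          rintro _ ⟨i, hi, rfl⟩
          have := mem_outside.1 hi
          exact ⟨haS ⟨i, this.1, rfl⟩, this.2⟩
        have h2 := h1.trans (Nat.mul_le_mul_left m (Set.ncard_le_ncard hsub))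
        have h3 : κ * m ≤ m * (S \ (H : Set G)).ncard := h.trans (by exact_mod_cast h2)
        rcases Nat.eq_zero_or_pos m with rfl | hmpos
        · exfalso
          have := hm {v} (by simpa using hv) (a v) (by simp)
          simp at this
        · have : (0 : ℝ) < m := by exact_mod_cast hmpos
          exact le_of_mul_le_mul_left (by linarith) this
      · exact Or.inr h
  have hmono : ∀ b : ℝ, T ≤ b → κ / 2 * (1 - κ / T) ≤ κ / 2 * (1 - κ / b) := by
    intro b hb
    have : κ / b ≤ κ / T := by gcongr
    gcongr
  by_cases hhalf : 2 * B.ncard ≤ Nat.card G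
  · exact (hmono _ hB1).trans
      (half_bound_le_of_shiftDefect_le h0 hκ hS (hκT.trans hB1) hhalf hl)
  · have e := Set.ncard_add_ncard_compl B
    have e' : (B.ncard : ℝ) + Bᶜ.ncard = Nat.card G := by exact_mod_cast e
    have hTc : T ≤ Bᶜ.ncard := by linarith
    refine (hmono _ hTc).trans
      (half_bound_le_of_shiftDefect_le h0 hκ hS (hκT.trans hTc) (by omega) ?_)
    simpa only [shiftDefect_compl] using hl

/-- The step of the greedy construction, in a coset of the subgroup generated by `a '' V`. -/
theorem exists_half_bound_le_shiftDefect [Finite G] {a : ι → G} {V : Finset ι}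
    {m : ℕ} (hm : MultiplicityLE a V m) {κ T : ℝ} (hκ : 0 < κ) (hκT : κ ≤ T)
    (hgen : ∀ K < AddSubgroup.closure (a '' V),
      κ * m ≤ (outside a V K).card ∨ κ ≤ Nat.card K)
    {B : Set G} {x : G}
    (hB1 : T ≤ (B ∩ (x +ᵥ (AddSubgroup.closure (a '' V) : Set G))).ncard)
    (hB2 : (B ∩ (x +ᵥ (AddSubgroup.closure (a '' V) : Set G))).ncard + T ≤
      Nat.card (AddSubgroup.closure (a '' V))) :
    ∃ v ∈ V, κ / 2 * (1 - κ / T) ≤ shiftDefect B (a v) := by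
  classical
  set L := AddSubgroup.closure (a '' V) with hL
  have haL : ∀ i ∈ V, a i ∈ L := fun i hi => AddSubgroup.subset_closure ⟨i, hi, rfl⟩
  -- The value `0` outside `L` is never met, since `a'` is only used on `V`.
  let a' : ι → L := fun i => if h : a i ∈ L then ⟨a i, h⟩ else 0
  have ha' : ∀ i ∈ V, (a' i : G) = a i := fun i hi => by simp [a', haL i hi]
  let C : Set L := {l | x + l ∈ B}
  have hinj : Function.Injective (fun l : L => x + (l : G)) := fun l l' h => by
    simpa using h
  have himg : (fun l : L => x + (l : G)) '' C = B ∩ (x +ᵥ (L : Set G)) := by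
    ext y
    constructor
    · rintro ⟨l, hl, rfl⟩
      exact ⟨hl, l, l.2, rfl⟩
    · rintro ⟨hy, l, hl, rfl⟩
      exact ⟨⟨l, hl⟩, hy, rfl⟩
  have hCcard : C.ncard = (B ∩ (x +ᵥ (L : Set G))).ncard := by
    rw [← himg, Set.ncard_image_of_injective _ hinj]
  rw [← hCcard] at hB1 hB2
  have hV : AddSubgroup.closure (a' '' V) = ⊤ := by
    apply AddSubgroup.map_injective (f := L.subtype) L.subtype_injective
    rw [AddMonoidHom.map_closure, ← AddMonoidHom.range_eq_map, AddSubgroup.range_subtype,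
      ← Set.image_comp]
    exact congrArg AddSubgroup.closure (Set.image_congr fun i hi => ha' i hi)
  have hm' : MultiplicityLE a' V m := fun J hJ g hg =>
    hm J hJ g fun j hj => by rw [← ha' j (hJ hj), hg j hj]
  obtain ⟨v, hv, hlam⟩ := exists_half_bound_le_shiftDefect_of_closure_eq_top hm' hV hκ hκT
    (fun K hK => by
      have hlt : K.map L.subtype < L := by
        refine lt_of_le_of_ne (AddSubgroup.map_subtype_le K) fun h => hK ?_
        apply AddSubgroup.map_injective (f := L.subtype) L.subtype_injective
        rw [h, ← AddMonoidHom.range_eq_map, AddSubgroup.range_subtype]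
      have hout : outside a V (K.map L.subtype) = outside a' V K := by
        ext i
        rw [mem_outside, mem_outside]
        refine and_congr_right fun hi => not_congr ?_
        rw [← ha' i hi]
        simp
      have hcard : Nat.card (K.map L.subtype) = Nat.card K :=
        AddSubgroup.card_map_of_injective L.subtype_injective
      have := hgen _ hlt
      rwa [hout, hcard] at this) hB1 hB2
  refine ⟨v, hv, hlam.trans ?_⟩
  -- Shifts by `a v ∈ L` preserve the coset `x + L`, so the defect seen inside it is part of the
  -- defect of `B`.
  have hsub : (fun l : L => x + (l : G)) '' ((a' v +ᵥ C) \ C) ⊆ (a v +ᵥ B) \ B := by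
    rintro _ ⟨_, ⟨⟨l, hl, rfl⟩, hl2⟩, rfl⟩
    refine ⟨⟨x + l, hl, ?_⟩, hl2⟩
    simp only [vadd_eq_add, AddSubgroup.coe_add, ha' v hv]
    abel
  have := Set.ncard_le_ncard hsub
  rw [Set.ncard_image_of_injective _ hinj] at this
  exact_mod_cast this

theorem zero_mem_sums (a : ι → G) (I : Finset ι) : (0 : G) ∈ sums a I :=
  ⟨∅, Finset.empty_subset _, Finset.sum_empty⟩

theorem sums_mono (a : ι → G) {I J : Finset ι} (h : I ⊆ J) : sums a I ⊆ sums a J := by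
  rintro _ ⟨K, hK, rfl⟩
  exact ⟨K, hK.trans h, rfl⟩

theorem mem_sums_of_mem (a : ι → G) {I : Finset ι} {i : ι} (hi : i ∈ I) : a i ∈ sums a I :=
  ⟨{i}, by simpa using hi, by simp⟩

theorem sums_subset {a : ι → G} {I : Finset ι} {K : AddSubgroup G} (h : ∀ i ∈ I, a i ∈ K) :
    sums a I ⊆ K := by
  rintro _ ⟨J, hJ, rfl⟩
  exact K.sum_mem fun i hi => h i (hJ hi)

theorem sums_within_subset (a : ι → G) (I : Finset ι) (K : AddSubgroup G) :
    sums a (within a I K) ⊆ K :=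
  sums_subset fun _ hi => (mem_within.1 hi).2

theorem within_eq_self {a : ι → G} {I : Finset ι} {K : AddSubgroup G} (h : ∀ i ∈ I, a i ∈ K) :
    within a I K = I := by
  ext i
  rw [mem_within]
  exact ⟨fun hi => hi.1, fun hi => ⟨hi, h i hi⟩⟩

theorem within_subset (a : ι → G) (I : Finset ι) (K : AddSubgroup G) : within a I K ⊆ I :=
  fun _ hi => (mem_within.1 hi).1

theorem within_mono (a : ι → G) {I J : Finset ι} (K : AddSubgroup G) (h : I ⊆ J) :
    within a I K ⊆ within a J K := by
  intro i hi
  rw [mem_within] at hi ⊢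
  exact ⟨h hi.1, hi.2⟩

theorem within_union_outside [DecidableEq ι] (a : ι → G) (I : Finset ι) (K : AddSubgroup G) :
    within a I K ∪ outside a I K = I := by
  ext i
  rw [Finset.mem_union, mem_within, mem_outside]
  tauto

theorem disjoint_within_outside (a : ι → G) (I : Finset ι) (K : AddSubgroup G) :
    Disjoint (within a I K) (outside a I K) := by
  rw [Finset.disjoint_left]
  intro i hi hi'
  exact (mem_outside.1 hi').2 (mem_within.1 hi).2

theorem sums_union [DecidableEq ι] (a : ι → G) {I J : Finset ι} (h : Disjoint I J) :
    sums a (I ∪ J) = sums a I + sums a J := by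
  ext g
  constructor
  · rintro ⟨K, hK, rfl⟩
    refine ⟨_, ⟨K ∩ I, Finset.inter_subset_right, rfl⟩, _,
      ⟨K ∩ J, Finset.inter_subset_right, rfl⟩, ?_⟩
    change _ + _ = _
    rw [← Finset.sum_union (h.mono Finset.inter_subset_right Finset.inter_subset_right),
      ← Finset.inter_union_distrib_left, Finset.inter_eq_left.2 hK]
  · rintro ⟨_, ⟨K, hK, rfl⟩, _, ⟨K', hK', rfl⟩, rfl⟩
    exact ⟨K ∪ K', Finset.union_subset_union hK hK', Finset.sum_union (h.mono hK hK')⟩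

theorem image_sums {G' : Type*} [AddCommGroup G'] (φ : G →+ G') (a : ι → G) (I : Finset ι) :
    φ '' sums a I = sums (φ ∘ a) I := by
  ext g
  constructor
  · rintro ⟨_, ⟨J, hJ, rfl⟩, rfl⟩
    exact ⟨J, hJ, by simp⟩
  · rintro ⟨J, hJ, rfl⟩
    exact ⟨_, ⟨J, hJ, rfl⟩, by simp⟩

theorem ncard_sums_insert [Finite G] [DecidableEq ι] (a : ι → G) {I : Finset ι} {i : ι}
    (hi : i ∉ I) : (sums a (insert i I)).ncard = (sums a I).ncard + shiftDefect (sums a I) (a i) := by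
  have h1 : sums a {i} = {0, a i} := by
    ext g
    constructor
    · rintro ⟨J, hJ, rfl⟩
      rcases Finset.subset_singleton_iff.1 hJ with rfl | rfl <;> simp
    · rintro (rfl | rfl)
      · exact zero_mem_sums a _
      · exact mem_sums_of_mem a (Finset.mem_singleton_self i)
  have h2 : sums a (insert i I) = sums a I ∪ ((a i +ᵥ sums a I) \ sums a I) := by
    rw [Finset.insert_eq, sums_union a (Finset.disjoint_singleton_left.2 hi), h1,
      Set.union_sdiff_self, Set.insert_eq, Set.union_add, Set.singleton_add, Set.singleton_add]
    simp only [zero_add, Set.image_id']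
    rfl
  rw [h2, Set.ncard_union_eq Set.disjoint_sdiff_right, shiftDefect]

/-- Each coset of `K` met by `Y` receives its own translate of `X`. -/
theorem ncard_mul_ncard_image_mk_le [Finite G] {K : AddSubgroup G} {X Y : Set G} (hX : X ⊆ K) :
    X.ncard * (QuotientAddGroup.mk' K '' Y).ncard ≤ (X + Y).ncard := by
  classical
  have hrep : ∀ c : G ⧸ K, ∃ y, c ∈ QuotientAddGroup.mk' K '' Y →
      y ∈ Y ∧ QuotientAddGroup.mk' K y = c := by
    intro c
    by_cases h : c ∈ QuotientAddGroup.mk' K '' Y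
    · obtain ⟨y, hy, hyc⟩ := h
      exact ⟨y, fun _ => ⟨hy, hyc⟩⟩
    · exact ⟨0, fun h' => absurd h' h⟩
  choose rep hrep using hrep
  rw [← Set.ncard_prod]
  refine Set.ncard_le_ncard_of_injOn (fun p => p.1 + rep p.2) ?_ ?_
  · rintro ⟨x, c⟩ ⟨hx, hc⟩
    exact ⟨x, hx, _, (hrep c hc).1, rfl⟩
  · rintro ⟨x, c⟩ ⟨hx, hc⟩ ⟨x', c'⟩ ⟨hx', hc'⟩ h
    have hzero : ∀ z ∈ X, QuotientAddGroup.mk' K z = 0 := fun z hz =>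
      (QuotientAddGroup.eq_zero_iff z).2 (hX hz)
    have h1 := congrArg (QuotientAddGroup.mk' K) h
    simp only [map_add] at h1
    rw [hzero x hx, hzero x' hx', (hrep c hc).2, (hrep c' hc').2, zero_add, zero_add] at h1
    subst h1
    simpa using h

theorem sums_quotient_outside (a : ι → G) (I : Finset ι) (K : AddSubgroup G) :
    sums (QuotientAddGroup.mk' K ∘ a) (outside a I K) = sums (QuotientAddGroup.mk' K ∘ a) I := by
  classical
  have h0 : sums (QuotientAddGroup.mk' K ∘ a) (within a I K) = {0} := by
    refine Set.Subset.antisymm ?_ (Set.singleton_subset_iff.2 (zero_mem_sums _ _))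
    rintro _ ⟨J, hJ, rfl⟩
    refine Finset.sum_eq_zero fun i hi => ?_
    exact (QuotientAddGroup.eq_zero_iff _).2 (mem_within.1 (hJ hi)).2
  conv_rhs => rw [← within_union_outside a I K, sums_union _ (disjoint_within_outside a I K), h0]
  simp

theorem ncard_sums_within_mul_le [Finite G] (a : ι → G) (I : Finset ι) (K : AddSubgroup G) :
    (sums a (within a I K)).ncard * (sums (QuotientAddGroup.mk' K ∘ a) I).ncard ≤
      (sums a I).ncard := by
  classical
  have h := ncard_mul_ncard_image_mk_le (Y := sums a (outside a I K)) (sums_within_subset a I K)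
  rwa [image_sums, sums_quotient_outside, ← sums_union a (disjoint_within_outside a I K),
    within_union_outside] at h

theorem two_mul_ncard_sums_within_le [Finite G] {a : ι → G} {I : Finset ι} {K : AddSubgroup G}
    (h : ¬ ∀ i ∈ I, a i ∈ K) : 2 * (sums a (within a I K)).ncard ≤ (sums a I).ncard := by
  push Not at h
  obtain ⟨i, hi, hiK⟩ := h
  refine le_trans ?_ (ncard_sums_within_mul_le a I K)
  rw [mul_comm]
  refine Nat.mul_le_mul_left _ ?_
  have hne : (0 : G ⧸ K) ≠ (QuotientAddGroup.mk' K ∘ a) i := fun h0 =>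
    hiK ((QuotientAddGroup.eq_zero_iff _).1 h0.symm)
  rw [← Set.ncard_pair hne]
  refine Set.ncard_le_ncard ?_
  rintro _ (rfl | rfl)
  · exact zero_mem_sums _ _
  · exact mem_sums_of_mem _ hi

/-! ### Stabilisers of sets of subset sums. -/

theorem add_mem_of_mem_stabilizer {S : Set G} {g s : G} (h : g ∈ AddAction.stabilizer G S)
    (hs : s ∈ S) : g + s ∈ S := by
  have h1 := AddAction.mem_stabilizer_iff.1 h
  rw [← h1]
  exact ⟨s, hs, rfl⟩

section Stabilizer

variable [Finite G]

theorem mem_stabilizer_of_vadd_subset {S : Set G} {g : G} (h : g +ᵥ S ⊆ S) :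
    g ∈ AddAction.stabilizer G S :=
  AddAction.mem_stabilizer_iff.2
    (Set.eq_of_subset_of_ncard_le h (Set.ncard_vadd_set g S).ge)

theorem mem_stabilizer_of_shiftDefect_eq_zero {S : Set G} {g : G} (h : shiftDefect S g = 0) :
    g ∈ AddAction.stabilizer G S :=
  mem_stabilizer_of_vadd_subset
    (Set.sdiff_eq_empty.1 ((Set.ncard_eq_zero).1 h))

/-- In a largest `U` with `|U| + 1 ≤ |sums a U|`, no further index can enlarge the sums, so all
remaining values stabilise `sums a U = sums a I` and hence vanish. -/
theorem card_outside_bot_lt {a : ι → G} {I : Finset ι}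
    (h : AddAction.stabilizer G (sums a I) = ⊥) :
    1 + (outside a I ⊥).card ≤ (sums a I).ncard := by
  classical
  obtain ⟨U, hU, hmax⟩ := Finset.exists_max_image
    (I.powerset.filter fun U => U.card + 1 ≤ (sums a U).ncard) Finset.card
    ⟨∅, by
      simp only [Finset.mem_filter, Finset.mem_powerset, Finset.empty_subset, Finset.card_empty,
        true_and]
      exact (Set.ncard_pos).2 ⟨0, zero_mem_sums a ∅⟩⟩
  rw [Finset.mem_filter, Finset.mem_powerset] at hU
  have hstab : ∀ i ∈ I \ U, a i ∈ AddAction.stabilizer G (sums a U) := by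
    intro i hi
    rw [Finset.mem_sdiff] at hi
    apply mem_stabilizer_of_shiftDefect_eq_zero
    by_contra hne
    have h1 := ncard_sums_insert a hi.2
    have h2 := Finset.card_insert_of_notMem hi.2
    have h3 := hmax (insert i U) (by
      rw [Finset.mem_filter, Finset.mem_powerset]
      exact ⟨Finset.insert_subset hi.1 hU.1, by omega⟩)
    omega
  have heq : sums a I = sums a U := by
    refine Set.Subset.antisymm ?_ (sums_mono a hU.1)
    rw [← Finset.union_sdiff_of_subset hU.1, sums_union a Finset.disjoint_sdiff]
    rintro _ ⟨x, hx, y, hy, rfl⟩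
    change x + y ∈ _
    rw [add_comm]
    exact add_mem_of_mem_stabilizer (sums_subset hstab hy) hx
  have hsub : outside a I ⊥ ⊆ U := by
    intro i hi
    rw [mem_outside] at hi
    by_contra hiU
    apply hi.2
    rw [← h, heq]
    exact hstab i (Finset.mem_sdiff.2 ⟨hi.1, hiU⟩)
  have := Finset.card_le_card hsub
  rw [heq]
  omega

/-- Modulo its stabiliser `D` the sum set has trivial stabiliser, so the previous bound applies
there; each class lifts to a full coset of `D`. -/
theorem card_stabilizer_mul_le (a : ι → G) (I : Finset ι) :
    Nat.card (AddAction.stabilizer G (sums a I)) *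
      (1 + (outside a I (AddAction.stabilizer G (sums a I))).card) ≤ (sums a I).ncard := by
  set D := AddAction.stabilizer G (sums a I) with hD
  have hstab : AddAction.stabilizer (G ⧸ D) (sums (QuotientAddGroup.mk' D ∘ a) I) = ⊥ := by
    rw [eq_bot_iff]
    intro c hc
    obtain ⟨g, rfl⟩ := QuotientAddGroup.mk'_surjective D c
    refine (QuotientAddGroup.eq_zero_iff g).2 ?_
    apply mem_stabilizer_of_vadd_subset
    rintro _ ⟨s, hs, rfl⟩
    have h1 : QuotientAddGroup.mk' D s ∈ sums (QuotientAddGroup.mk' D ∘ a) I := by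
      rw [← image_sums]; exact ⟨s, hs, rfl⟩
    have h2 := add_mem_of_mem_stabilizer hc h1
    rw [← image_sums, ← map_add] at h2
    obtain ⟨t, ht, hts⟩ := h2
    have h3 : -t + (g + s) ∈ D := QuotientAddGroup.eq.1 hts
    have h4 := add_mem_of_mem_stabilizer h3 ht
    simpa [add_comm, add_assoc, add_left_comm] using h4
  have h1 := card_outside_bot_lt hstab
  have h2 : outside (QuotientAddGroup.mk' D ∘ a) I ⊥ = outside a I D := by
    ext i
    rw [mem_outside, mem_outside, AddSubgroup.mem_bot]
    exact and_congr_right fun _ => not_congr (QuotientAddGroup.eq_zero_iff (a i))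
  rw [h2, ← image_sums] at h1
  have h3 := ncard_mul_ncard_image_mk_le (K := D) (X := (D : Set G)) (Y := sums a I) le_rfl
  have h4 : (D : Set G) + sums a I ⊆ sums a I := by
    rintro _ ⟨d, hd, s, hs, rfl⟩
    exact add_mem_of_mem_stabilizer hd hs
  exact (Nat.mul_le_mul_left _ h1).trans (h3.trans (Set.ncard_le_ncard h4))

end Stabilizer

/-! ### Admissible families and a weak quadratic bound. -/

/-- A family of nonzero elements, each taken at most `m` times, whose members in any nontrivial
subgroup do not have all elements of that subgroup as subset sums. -/
structure Admissible (a : ι → G) (I : Finset ι) (m : ℕ) : Prop where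
  ne_zero : ∀ i ∈ I, a i ≠ 0
  multiplicity : MultiplicityLE a I m
  incomplete : ∀ K : AddSubgroup G, K ≠ ⊥ → sums a (within a I K) ≠ K

theorem Admissible.mono {a : ι → G} {I J : Finset ι} {m : ℕ} (h : Admissible a I m) (hJ : J ⊆ I) :
    Admissible a J m where
  ne_zero i hi := h.ne_zero i (hJ hi)
  multiplicity := h.multiplicity.mono hJ
  incomplete K hK hs := h.incomplete K hK <| Set.Subset.antisymm (sums_within_subset a I K)
    (hs ▸ sums_mono a (within_mono a K hJ))

theorem Admissible.not_subset_sums {a : ι → G} {I : Finset ι} {m : ℕ} (h : Admissible a I m)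
    {K : AddSubgroup G} (hK : ∀ i ∈ I, a i ∈ K) (hI : I.Nonempty) : ¬ (K : Set G) ⊆ sums a I := by
  intro hs
  obtain ⟨i, hi⟩ := hI
  refine h.incomplete K ?_ ?_
  · rintro rfl
    exact h.ne_zero i hi (hK i hi)
  · rw [within_eq_self hK]
    exact Set.Subset.antisymm (sums_subset hK) hs

theorem Admissible.one_le {a : ι → G} {I : Finset ι} {m : ℕ} (h : Admissible a I m)
    (hI : I.Nonempty) : 1 ≤ m := by
  obtain ⟨i, hi⟩ := hI
  simpa using h.multiplicity {i} (by simpa using hi) (a i) (by simp)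

/-- The stabiliser `D` of the sums lies inside them, so admissibility keeps some index outside `D`.
Induction on the part within `D` bounds `|D|` from below, and `|D|(1 + o) ≥ |D| + o` accounts for
the `o` indices outside. -/
theorem Admissible.card_lt_ncard_sums [Finite G] {a : ι → G} {I : Finset ι} {m : ℕ}
    (h : Admissible a I m) : I.card + 1 ≤ (sums a I).ncard := by
  induction hn : I.card using Nat.strong_induction_on generalizing I with
  | _ n ih =>
  subst hn
  set D := AddAction.stabilizer G (sums a I) with hD
  have h1 := card_stabilizer_mul_le a I
  rw [← hD] at h1
  have h2 := card_within_add_card_outside a I D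
  have hDsub : (D : Set G) ⊆ sums a I := fun g hg => by
    have := add_mem_of_mem_stabilizer (hD ▸ hg) (zero_mem_sums a I)
    simpa using this
  by_cases hI : I.Nonempty
  · have hlt : (within a I D).card < I.card := by
      refine Finset.card_lt_card (Finset.ssubset_iff_subset_ne.2 ⟨within_subset a I D, ?_⟩)
      intro he
      refine h.not_subset_sums (K := D) (fun i hi => ?_) hI hDsub
      rw [← he] at hi
      exact (mem_within.1 hi).2
    have h3 := ih _ hlt (h.mono (within_subset a I D)) rfl
    have h4 : (sums a (within a I D)).ncard ≤ Nat.card D :=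
      Set.ncard_le_ncard (sums_within_subset a I D)
    nlinarith
  · rw [Finset.not_nonempty_iff_eq_empty] at hI
    subst hI
    simpa [Nat.one_le_iff_ne_zero, Nat.pos_iff_ne_zero] using
      (Set.ncard_pos).2 ⟨0, zero_mem_sums a ∅⟩

/-- For `g` in the coset, `X` and `g - Y` both lie in it and are too large to be disjoint. -/
theorem coset_subset_add [Finite G] {L : AddSubgroup G} {X Y : Set G} {x : G}
    (hX : X ⊆ x +ᵥ (L : Set G)) (hY : Y ⊆ L) (h : Nat.card L < X.ncard + Y.ncard) :
    x +ᵥ (L : Set G) ⊆ X + Y := by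
  rintro g hg
  have hY' : (fun y => g - y) '' Y ⊆ x +ᵥ (L : Set G) := by
    rintro _ ⟨y, hy, rfl⟩
    obtain ⟨l, hl, rfl⟩ := hg
    exact ⟨l - y, L.sub_mem hl (hY hy), by simp [add_sub_assoc]⟩
  have h1 : ((fun y => g - y) '' Y).ncard = Y.ncard :=
    Set.ncard_image_of_injective _ sub_right_injective
  have h2 := Set.ncard_union_add_ncard_inter X ((fun y => g - y) '' Y)
  have h3 := Set.ncard_le_ncard (Set.union_subset hX hY')
  rw [Set.ncard_vadd_set] at h3
  have h4 : (L : Set G).ncard = Nat.card L := rfl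
  obtain ⟨z, hzX, y, hy, rfl⟩ : (X ∩ ((fun y => g - y) '' Y)).Nonempty :=
    (Set.ncard_pos).1 (by omega)
  exact ⟨_, hzX, y, hy, by simp⟩

section WeakBound

variable [Finite G] {a : ι → G} {I : Finset ι} {m : ℕ}

/-- Each step gains `t / (8m)`, from `κ = t / (2m)` and `T = t`, until half of the generated group
is filled. More than `8t` indices lie outside any subgroup not containing the family, and at most
`4t` have been discarded, so at least `t` remain available outside it. The slack `2t` in `W` lets
the construction run twice on disjoint index sets. -/
theorem Admissible.exists_growing_subset [DecidableEq ι] (h : Admissible a I m)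
    (hrob : ∀ K : AddSubgroup G, (∀ i ∈ I, a i ∈ K) ∨ I.card < 4 * (outside a I K).card)
    {t : ℕ} (ht : 0 < t) (htI : 32 * t ≤ I.card) {W : Finset ι} (hW : W ⊆ I)
    (hWcard : I.card ≤ W.card + 2 * t) {s : ℕ} (hs : s ≤ t) :
    ∃ U ⊆ W, U.card = t + s ∧ ((s : ℝ) * (t / (8 * m)) ≤ (sums a U).ncard ∨
      Nat.card (AddSubgroup.closure (a '' I)) < 2 * (sums a U).ncard) := by
  induction s with
  | zero =>
    obtain ⟨U, hU, hcard⟩ := Finset.exists_subset_card_eq (show t ≤ W.card by omega)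
    exact ⟨U, hU, hcard, Or.inl (by simp)⟩
  | succ s ih =>
    obtain ⟨U, hUW, hUcard, hU⟩ := ih (by omega)
    have hm : (1 : ℝ) ≤ m := by
      exact_mod_cast h.one_le (Finset.card_pos.1 (by omega))
    rcases Nat.lt_or_ge (Nat.card (AddSubgroup.closure (a '' I))) (2 * (sums a U).ncard) with hb | hb
    · obtain ⟨i, hi⟩ : (W \ U).Nonempty := by
        rw [← Finset.card_pos, Finset.card_sdiff_of_subset hUW]; omega
      rw [Finset.mem_sdiff] at hi
      refine ⟨insert i U, Finset.insert_subset hi.1 hUW, ?_, Or.inr ?_⟩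
      · rw [Finset.card_insert_of_notMem hi.2]; omega
      · rw [ncard_sums_insert a hi.2]; omega
    have hU := hU.resolve_right (by omega)
    set V := W \ U with hV
    have hVI : V ⊆ I := Finset.sdiff_subset.trans hW
    have hVcard : I.card ≤ V.card + 4 * t := by
      rw [hV, Finset.card_sdiff_of_subset hUW]; omega
    have hout : ∀ K : AddSubgroup G, (∀ i ∈ I, a i ∈ K) ∨ t ≤ (outside a V K).card := by
      intro K
      refine (hrob K).imp_right fun hK => ?_
      have hsub : outside a I K ⊆ outside a V K ∪ (I \ V) := by
        intro i hi
        rw [mem_outside] at hi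
        by_cases hiV : i ∈ V
        · exact Finset.mem_union_left _ (mem_outside.2 ⟨hiV, hi.2⟩)
        · exact Finset.mem_union_right _ (Finset.mem_sdiff.2 ⟨hi.1, hiV⟩)
      have h1 := (Finset.card_le_card hsub).trans (Finset.card_union_le _ _)
      rw [Finset.card_sdiff_of_subset hVI] at h1
      omega
    have hcl : AddSubgroup.closure (a '' V) = AddSubgroup.closure (a '' I) := by
      refine le_antisymm (AddSubgroup.closure_mono (Set.image_mono hVI)) ?_
      rw [AddSubgroup.closure_le]
      rcases hout (AddSubgroup.closure (a '' V)) with h1 | h1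
      · rintro _ ⟨i, hi, rfl⟩
        exact h1 i hi
      · obtain ⟨i, hi⟩ := Finset.card_pos.1 (show
          0 < (outside a V (AddSubgroup.closure (a '' V))).card by omega)
        rw [mem_outside] at hi
        exact absurd (AddSubgroup.subset_closure (Set.mem_image_of_mem a hi.1)) hi.2
    have hUI : ∀ i ∈ U, a i ∈ AddSubgroup.closure (a '' I) := fun i hi =>
      AddSubgroup.subset_closure ⟨i, hW (hUW hi), rfl⟩
    have hinter : sums a U ∩ ((0 : G) +ᵥ (AddSubgroup.closure (a '' V) : Set G)) = sums a U := by
      rw [zero_vadd, hcl]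
      exact Set.inter_eq_left.2 (sums_subset hUI)
    have hUcard' := (h.mono (hUW.trans hW)).card_lt_ncard_sums
    have ht' : (0 : ℝ) < t := by exact_mod_cast ht
    have htU : (t : ℝ) ≤ (sums a U).ncard := by
      have : t ≤ (sums a U).ncard := by omega
      exact_mod_cast this
    have hκT : (t : ℝ) / (2 * m) ≤ t / 2 := by gcongr; linarith
    obtain ⟨v, hv, hlam⟩ := exists_half_bound_le_shiftDefect (h.multiplicity.mono hVI)
      (κ := t / (2 * m)) (T := t) (B := sums a U) (x := 0) (by positivity) (by linarith) (by
        intro K hK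
        left
        rcases hout K with h1 | h1
        · refine absurd hK (not_lt_of_ge ?_)
          rw [AddSubgroup.closure_le]
          rintro _ ⟨i, hi, rfl⟩
          exact h1 i (hVI hi)
        · have h2 : (t : ℝ) ≤ (outside a V K).card := by exact_mod_cast h1
          have h3 : (t : ℝ) / (2 * m) * m = t / 2 := by field_simp
          rw [h3]; linarith)
      (by rw [hinter]; exact htU)
      (by
        rw [hinter, hcl]
        have : (2 : ℝ) * (sums a U).ncard ≤ Nat.card (AddSubgroup.closure (a '' I)) := by
          exact_mod_cast hb
        linarith)
    rw [hV, Finset.mem_sdiff] at hv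
    refine ⟨insert v U, Finset.insert_subset hv.1 hUW, ?_, Or.inl ?_⟩
    · rw [Finset.card_insert_of_notMem hv.2]; omega
    · rw [ncard_sums_insert a hv.2]
      have h4 : (t : ℝ) / (8 * m) ≤ t / (2 * m) / 2 * (1 - t / (2 * m) / t) := by
        have : (t : ℝ) / (2 * m) / t ≤ 1 / 2 := by
          rw [div_le_iff₀ ht']; linarith
        calc (t : ℝ) / (8 * m) = t / (2 * m) / 2 * (1 - 1 / 2) := by field_simp; norm_num
          _ ≤ _ := by gcongr
      push_cast
      linarith

/-- Here `32768 = 64² · 8`: with `t = ⌊n / 32⌋` one has `n ≤ 64t`, and one run of the growth yields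
`t² / (8m)` sums. If two disjoint runs both exceed half of the generated group, together they fill
it, against admissibility. -/
theorem Admissible.sq_card_le (h : Admissible a I m) :
    (I.card : ℝ) ^ 2 ≤ 32768 * m * (sums a I).ncard := by
  classical
  induction hn : I.card using Nat.strong_induction_on generalizing I with
  | _ n ih =>
  subst hn
  rcases I.eq_empty_or_nonempty with rfl | hI
  · simp; positivity
  have hm : (1 : ℝ) ≤ m := by exact_mod_cast h.one_le hI
  by_cases hsmall : I.card < 32
  · have h1 : (I.card : ℝ) + 1 ≤ (sums a I).ncard := by exact_mod_cast h.card_lt_ncard_sums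
    have h2 : (I.card : ℝ) ≤ 32 := by exact_mod_cast hsmall.le
    have h3 : (0 : ℝ) ≤ I.card := Nat.cast_nonneg _
    nlinarith
  by_cases hrob : ∀ K : AddSubgroup G, (∀ i ∈ I, a i ∈ K) ∨ I.card < 4 * (outside a I K).card
  · set t := I.card / 32 with ht
    have htI : 32 * t ≤ I.card := by omega
    have hI64 : (I.card : ℝ) ≤ 64 * t := by
      have : I.card ≤ 64 * t := by omega
      exact_mod_cast this
    have hdone : ∀ U ⊆ I, (t : ℝ) * (t / (8 * m)) ≤ (sums a U).ncard →
        (I.card : ℝ) ^ 2 ≤ 32768 * m * (sums a I).ncard := by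
      intro U hU hle
      have h1 : ((sums a U).ncard : ℝ) ≤ (sums a I).ncard := by
        exact_mod_cast Set.ncard_le_ncard (sums_mono a hU)
      have h2 : (t : ℝ) ^ 2 ≤ 8 * m * (sums a I).ncard := by
        have := hle.trans h1
        rw [← mul_div_assoc, div_le_iff₀ (by positivity)] at this
        linarith
      calc (I.card : ℝ) ^ 2 ≤ (64 * t) ^ 2 := by gcongr
        _ = 4096 * (t : ℝ) ^ 2 := by ring
        _ ≤ _ := by linarith
    obtain ⟨U₁, hU₁, hc₁, hs₁⟩ := h.exists_growing_subset hrob (by omega) htI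
      (W := I) (Finset.Subset.refl I) (by omega) (le_refl t)
    rcases hs₁ with hs₁ | hs₁
    · exact hdone U₁ hU₁ hs₁
    obtain ⟨U₂, hU₂, hc₂, hs₂⟩ := h.exists_growing_subset hrob (by omega) htI
      (W := I \ U₁) Finset.sdiff_subset
      (by rw [Finset.card_sdiff_of_subset hU₁]; omega) (le_refl t)
    rcases hs₂ with hs₂ | hs₂
    · exact hdone U₂ (hU₂.trans Finset.sdiff_subset) hs₂
    exfalso
    have hIL : ∀ i ∈ I, a i ∈ AddSubgroup.closure (a '' I) := fun i hi =>
      AddSubgroup.subset_closure ⟨i, hi, rfl⟩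
    refine h.not_subset_sums hIL hI ?_
    have hcov := coset_subset_add (L := AddSubgroup.closure (a '' I)) (x := 0)
      (X := sums a U₁) (Y := sums a U₂)
      (by rw [zero_vadd]; exact sums_subset fun i hi => hIL i (hU₁ hi))
      (sums_subset fun i hi => hIL i (Finset.sdiff_subset (hU₂ hi))) (by omega)
    rw [zero_vadd, ← sums_union a (Finset.disjoint_of_subset_right hU₂ Finset.disjoint_sdiff)] at hcov
    exact hcov.trans (sums_mono a (Finset.union_subset hU₁ (hU₂.trans Finset.sdiff_subset)))
  -- Otherwise some proper part of size at least `3n / 4` lies in a subgroup, and restricting to it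
  -- at least halves the sums; induction closes because `(4 / 3)² ≤ 2`.
  · push Not at hrob
    obtain ⟨K, ⟨i, hi, hiK⟩, hK⟩ := hrob
    have h1 := card_within_add_card_outside a I K
    have h2 : 0 < (outside a I K).card := Finset.card_pos.2 ⟨i, mem_outside.2 ⟨hi, hiK⟩⟩
    have h3 := ih _ (by omega) (h.mono (within_subset a I K)) rfl
    have h4 : (2 : ℝ) * (sums a (within a I K)).ncard ≤ (sums a I).ncard := by
      exact_mod_cast two_mul_ncard_sums_within_le (fun hall => hiK (hall i hi))
    have h5 : (3 : ℝ) * I.card ≤ 4 * (within a I K).card := by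
      have : 3 * I.card ≤ 4 * (within a I K).card := by omega
      exact_mod_cast this
    have h6 : (3 * (I.card : ℝ)) ^ 2 ≤ (4 * (within a I K).card) ^ 2 := by gcongr
    have h7 : 32768 * (m : ℝ) * (2 * (sums a (within a I K)).ncard) ≤
        32768 * m * (sums a I).ncard := by gcongr
    nlinarith

end WeakBound

/-! ### Reserves and robust subfamilies. -/

theorem two_pow_card_le_ncard_sums [Finite G] [DecidableEq ι] {a : ι → G} {X : Finset ι}
    (hX : ∀ x ∈ X, a x ∉ AddSubgroup.closure (a '' (X.erase x))) :
    2 ^ X.card ≤ (sums a X).ncard := by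
  -- Two subsets with equal sums that differ at `x` would express `a x` through the other members of
  -- `X`.
  have key : ∀ B ⊆ X, ∀ B' ⊆ X, ∑ i ∈ B, a i = ∑ i ∈ B', a i → B ⊆ B' := by
    intro B hB B' hB' h x hx
    by_contra hx'
    apply hX x (hB hx)
    have h1 : a x = ∑ i ∈ B', a i - ∑ i ∈ B.erase x, a i := by
      rw [← h, ← Finset.add_sum_erase B a hx]; simp
    rw [h1]
    refine AddSubgroup.sub_mem _ (AddSubgroup.sum_mem _ fun i hi => ?_)
      (AddSubgroup.sum_mem _ fun i hi => ?_)
    · refine AddSubgroup.subset_closure (Set.mem_image_of_mem a ?_)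
      exact Finset.mem_erase.2 ⟨fun h => hx' (h ▸ hi), hB' hi⟩
    · exact AddSubgroup.subset_closure
        (Set.mem_image_of_mem a (Finset.erase_subset_erase x hB hi))
  rw [← Finset.card_powerset, ← Set.ncard_coe_finset]
  refine Set.ncard_le_ncard_of_injOn (fun B => ∑ i ∈ B, a i) ?_ ?_
  · intro B hB
    exact ⟨B, Finset.mem_powerset.1 hB, rfl⟩
  · intro B hB B' hB' h
    have hB := Finset.mem_powerset.1 hB
    have hB' := Finset.mem_powerset.1 hB'
    exact Finset.Subset.antisymm (key B hB B' hB' h) (key B' hB' B hB h.symm)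

theorem exists_small_generating_subset [Finite G] (a : ι → G) (J : Finset ι) :
    ∃ X ⊆ J, AddSubgroup.closure (a '' X) = AddSubgroup.closure (a '' J) ∧
      2 ^ X.card ≤ (sums a X).ncard := by
  classical
  obtain ⟨X, hX, hmin⟩ := Finset.exists_min_image
    (J.powerset.filter fun X : Finset ι => AddSubgroup.closure (a '' X) = AddSubgroup.closure (a '' J))
    Finset.card ⟨J, by simp⟩
  rw [Finset.mem_filter, Finset.mem_powerset] at hX
  refine ⟨X, hX.1, hX.2, two_pow_card_le_ncard_sums fun x hx hmem => ?_⟩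
  have h1 := hmin (X.erase x) (by
    rw [Finset.mem_filter, Finset.mem_powerset]
    refine ⟨(Finset.erase_subset _ _).trans hX.1, le_antisymm ?_ ?_⟩
    · exact AddSubgroup.closure_mono (Set.image_mono ((Finset.erase_subset _ _).trans hX.1))
    · rw [← hX.2, AddSubgroup.closure_le]
      rintro _ ⟨i, hi, rfl⟩
      by_cases hix : i = x
      · rw [hix]; exact hmem
      · exact AddSubgroup.subset_closure
          (Set.mem_image_of_mem a (Finset.mem_erase.2 ⟨hix, hi⟩)))
  have := Finset.card_erase_lt_of_mem hx
  omega

/-- The reserve is a union of `N` successive minimal generating sets of what remains. Each has at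
most `d` elements because its subset sums are distinct, and each contributes a new element outside
`K`, since `R` is too small to exhaust the indices outside `K`. -/
theorem exists_reserve [Finite G] {a : ι → G} {I : Finset ι} {d ρ : ℝ}
    (hd : ∀ k : ℕ, (2 : ℝ) ^ k ≤ (sums a I).ncard → (k : ℝ) ≤ d)
    (hρ : ∀ K : AddSubgroup G, (∀ i ∈ I, a i ∈ K) ∨ ρ < (outside a I K).card) (N : ℕ)
    (hN : N * d ≤ ρ) :
    ∃ R ⊆ I, (R.card : ℝ) ≤ N * d ∧
      ∀ K : AddSubgroup G, (∀ i ∈ I, a i ∈ K) ∨ N ≤ (outside a R K).card := by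
  classical
  have hd0 : 0 ≤ d := by
    have := hd 0 (by
      have := (Set.ncard_pos).2 (⟨0, zero_mem_sums a I⟩ : (sums a I).Nonempty)
      rw [pow_zero]; exact_mod_cast this)
    simpa using this
  induction N with
  | zero => exact ⟨∅, by simp, by simp, fun K => Or.inr (Nat.zero_le _)⟩
  | succ N ih =>
    push_cast at hN ⊢
    obtain ⟨R, hR, hRcard, hRout⟩ := ih (by linarith)
    obtain ⟨X, hX, hXcl, hXcard⟩ := exists_small_generating_subset a (I \ R)
    have hXI : X ⊆ I := hX.trans Finset.sdiff_subset
    have hXd : (X.card : ℝ) ≤ d := by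
      apply hd
      exact_mod_cast hXcard.trans (Set.ncard_le_ncard (sums_mono a hXI))
    refine ⟨R ∪ X, Finset.union_subset hR hXI, ?_, fun K => ?_⟩
    · have : ((R ∪ X).card : ℝ) ≤ R.card + X.card := by exact_mod_cast Finset.card_union_le R X
      linarith
    · by_cases hall : ∀ i ∈ I, a i ∈ K
      · exact Or.inl hall
      right
      have h1 := (hRout K).resolve_left hall
      have h2 := (hρ K).resolve_left hall
      have h3 : R.card < (outside a I K).card := by
        have : (R.card : ℝ) < (outside a I K).card := by linarith
        exact_mod_cast this
      obtain ⟨i, hi, hiR⟩ := Finset.exists_mem_notMem_of_card_lt_card h3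
      rw [mem_outside] at hi
      obtain ⟨x, hx, hxK⟩ : ∃ x ∈ X, a x ∉ K := by
        by_contra! hcon
        apply hi.2
        have h4 : AddSubgroup.closure (a '' X) ≤ K := by
          rw [AddSubgroup.closure_le]
          rintro _ ⟨x, hx, rfl⟩
          exact hcon x hx
        rw [hXcl] at h4
        exact h4 (AddSubgroup.subset_closure (Set.mem_image_of_mem a
          (Finset.mem_coe.2 (Finset.mem_sdiff.2 ⟨hi.1, hiR⟩))))
      have h5 : insert x (outside a R K) ⊆ outside a (R ∪ X) K := by
        intro y hy
        rw [Finset.mem_insert, mem_outside] at hy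
        rw [mem_outside, Finset.mem_union]
        rcases hy with rfl | hy
        · exact ⟨Or.inr hx, hxK⟩
        · exact ⟨Or.inl hy.1, hy.2⟩
      have h6 : x ∉ outside a R K := fun h =>
        (Finset.mem_sdiff.1 (hX hx)).2 (mem_outside.1 h).1
      have h7 := Finset.card_le_card h5
      rw [Finset.card_insert_of_notMem h6] at h7
      omega

/-- Modulo `K`, the stabiliser of the sums of `R` omits fewer than `N` indices of `R`, so by the
reserve property it contains every value of the family. The sums of `R` thus meet every coset of `K`
in the generated group. -/
theorem exists_mem_sums_sub_mem [Finite G] {a : ι → G} {I R : Finset ι} {N : ℕ} (hRI : R ⊆ I)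
    (hR : ∀ K : AddSubgroup G, (∀ i ∈ I, a i ∈ K) ∨ N ≤ (outside a R K).card)
    {K : AddSubgroup G} (hK : (sums (QuotientAddGroup.mk' K ∘ a) I).ncard ≤ N)
    {l : G} (hl : l ∈ AddSubgroup.closure (a '' I)) :
    ∃ r ∈ sums a R, l - r ∈ K := by
  set π := QuotientAddGroup.mk' K
  set D := AddAction.stabilizer (G ⧸ K) (sums (π ∘ a) R) with hD
  have h1 := card_stabilizer_mul_le (π ∘ a) R
  rw [← hD] at h1
  have h2 : (sums (π ∘ a) R).ncard ≤ N := (Set.ncard_le_ncard (sums_mono _ hRI)).trans hK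
  have h3 : outside (π ∘ a) R D = outside a R (D.comap π) := by
    ext i
    rw [mem_outside, mem_outside]
    rfl
  have h4 : 0 < Nat.card D := Nat.card_pos
  rw [h3] at h1
  have h5 := (hR (D.comap π)).resolve_right (by nlinarith)
  have h6 : l ∈ D.comap π := by
    refine (AddSubgroup.closure_le _).2 ?_ hl
    rintro _ ⟨i, hi, rfl⟩
    exact h5 i hi
  have h7 : π l + 0 ∈ sums (π ∘ a) R := add_mem_of_mem_stabilizer h6 (zero_mem_sums _ _)
  rw [add_zero, ← image_sums] at h7
  obtain ⟨r, hr, hrl⟩ := h7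
  refine ⟨r, hr, ?_⟩
  rw [sub_eq_neg_add]
  exact QuotientAddGroup.eq.1 hrl

theorem exists_large_inter_coset [Finite G] {B : Set G} (hB : B.Nonempty) {K : AddSubgroup G}
    {N : ℕ} (hN : (QuotientAddGroup.mk' K '' B).ncard ≤ N) :
    ∃ x ∈ B, B.ncard ≤ N * (B ∩ (x +ᵥ (K : Set G))).ncard := by
  classical
  cases nonempty_fintype G
  obtain ⟨x, hx, hmax⟩ := Finset.exists_max_image B.toFinset
    (fun x => (B ∩ (x +ᵥ (K : Set G))).ncard) (by simpa using hB)
  refine ⟨x, by simpa using hx, ?_⟩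
  have h1 := Finset.card_le_mul_card_image (f := QuotientAddGroup.mk' K) B.toFinset
    (B ∩ (x +ᵥ (K : Set G))).ncard (by
      intro c hc
      rw [Finset.mem_image] at hc
      obtain ⟨y, hy, rfl⟩ := hc
      refine le_trans (le_of_eq ?_) (hmax y hy)
      rw [← Set.ncard_coe_finset]
      congr 1
      ext z
      simp only [Finset.coe_filter, Set.mem_toFinset, Set.mem_ofPred_eq, Set.mem_inter_iff,
        Set.mem_vadd_set_iff_neg_vadd_mem, vadd_eq_add, SetLike.mem_coe]
      refine and_congr_right fun _ => ?_
      rw [eq_comm]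
      exact QuotientAddGroup.eq)
  rw [← Set.ncard_coe_finset (B.toFinset.image _), Finset.coe_image, Set.coe_toFinset,
    ← Set.ncard_eq_toFinset_card'] at h1
  rw [mul_comm]
  exact h1.trans (Nat.mul_le_mul_left _ hN)

/-- As long as some subgroup omits between `1` and `ρ` indices, restricting to it costs at most `ρ`
indices and at least halves the number of sums. -/
theorem exists_robust_subset [Finite G] (a : ι → G) (I : Finset ι) {ρ : ℝ} (hρ : 0 ≤ ρ) (j : ℕ) :
    (∃ I' ⊆ I, (I.card : ℝ) ≤ I'.card + j * ρ ∧
      ∀ K : AddSubgroup G, (∀ i ∈ I', a i ∈ K) ∨ ρ < (outside a I' K).card) ∨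
    ∃ I' ⊆ I, (I.card : ℝ) ≤ I'.card + j * ρ ∧ 2 ^ j * (sums a I').ncard ≤ (sums a I).ncard := by
  induction j with
  | zero => exact Or.inr ⟨I, Finset.Subset.refl I, by simp, by simp⟩
  | succ j ih =>
    push_cast
    rcases ih with ⟨I', hI', hc, hr⟩ | ⟨I', hI', hc, hs⟩
    · exact Or.inl ⟨I', hI', by linarith, hr⟩
    · by_cases hr : ∀ K : AddSubgroup G, (∀ i ∈ I', a i ∈ K) ∨ ρ < (outside a I' K).card
      · exact Or.inl ⟨I', hI', by linarith, hr⟩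
      · push Not at hr
        obtain ⟨K, ⟨i, hi, hiK⟩, hK⟩ := hr
        refine Or.inr ⟨within a I' K, (within_subset a I' K).trans hI', ?_, ?_⟩
        · have h1 : ((within a I' K).card : ℝ) + (outside a I' K).card = I'.card := by
            exact_mod_cast card_within_add_card_outside a I' K
          linarith
        · have h2 := two_mul_ncard_sums_within_le (fun h : ∀ i ∈ I', a i ∈ K => hiK (h i hi))
          calc 2 ^ (j + 1) * (sums a (within a I' K)).ncard
              = 2 ^ j * (2 * (sums a (within a I' K)).ncard) := by ring
            _ ≤ 2 ^ j * (sums a I').ncard := Nat.mul_le_mul_left _ h2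
            _ ≤ _ := hs

/-! ### The greedy construction with the sharp constant. -/

section Reserve

variable [Finite G] {a : ι → G} {I R : Finset ι} {m N : ℕ} {ε : ℝ}

theorem Admissible.le_ncard_sums_of_le_card (h : Admissible a I m) {V : Finset ι} (hV : V ⊆ I)
    (hm : 1 ≤ m) (hε : 0 < ε) (hVcard : ε ^ 2 * I.card ≤ V.card) :
    ε ^ 4 / 32768 * I.card ^ 2 / m ≤ (sums a V).ncard := by
  have h1 := (h.mono hV).sq_card_le
  have h2 : (ε ^ 2 * I.card) ^ 2 ≤ (V.card : ℝ) ^ 2 := by gcongr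
  have hm' : (0 : ℝ) < m := by exact_mod_cast hm
  rw [div_le_iff₀ hm']
  nlinarith

set_option maxHeartbeats 1000000 in
/-- A single step of the greedy construction, when `R` is held in reserve. -/
theorem Admissible.exists_shiftDefect_of_reserve [DecidableEq ι] (h : Admissible a I m)
    (hε : 0 < ε) (hε1 : ε ≤ 1 / 8) (hRI : R ⊆ I)
    (hR : ∀ K : AddSubgroup G, (∀ i ∈ I, a i ∈ K) ∨ N ≤ (outside a R K).card)
    (hN : 8192 ≤ N * ε ^ 4) (hn : 32768 * (N + 1) ≤ ε ^ 5 * I.card)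
    (hsmall : (m : ℝ) * (sums a I).ncard < I.card ^ 2 / 4)
    {U V : Finset ι} (hUV : Disjoint U V) (hUVI : U ∪ V = I \ R)
    (hU : ε * I.card ≤ U.card) (hV : ε * I.card ≤ V.card) :
    ∃ v ∈ V, (1 - 2 * ε) * V.card / (2 * m) ≤ shiftDefect (sums a U) (a v) := by
  have hUI : U ⊆ I := (Finset.subset_union_left.trans hUVI.le).trans Finset.sdiff_subset
  have hVI : V ⊆ I := (Finset.subset_union_right.trans hUVI.le).trans Finset.sdiff_subset
  set n : ℝ := (I.card : ℝ) with hndef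
  have hn1 : 0 < n := by
    by_contra hcon
    have h1 : ε ^ 5 * n ≤ 0 := mul_nonpos_of_nonneg_of_nonpos (by positivity) (not_lt.1 hcon)
    have h2 : (0 : ℝ) ≤ N := Nat.cast_nonneg N
    linarith
  have hI : I.Nonempty := by
    rw [← Finset.card_pos]; rw [hndef] at hn1; exact_mod_cast hn1
  have hm := h.one_le hI
  have hm' : (1 : ℝ) ≤ m := by exact_mod_cast hm
  have hN0 : (0 : ℝ) ≤ N := Nat.cast_nonneg N
  have hε2 : ε ^ 2 * n ≤ ε * n := by
    apply mul_le_mul_of_nonneg_right _ hn1.le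
    nlinarith
  set c : ℝ := ε ^ 4 / 32768 with hc
  have hc0 : 0 < c := by positivity
  have hcn : (N + 1) ≤ ε * (c * n) := by rw [hc]; linarith [hn]
  have hweak : ∀ W ⊆ I, ε ^ 2 * n ≤ W.card → c * n ^ 2 / m ≤ (sums a W).ncard := fun W hW hWc =>
    h.le_ncard_sums_of_le_card hW hm hε hWc
  set L := AddSubgroup.closure (a '' V) with hL
  have hVL : ∀ i ∈ V, a i ∈ L := fun i hi => AddSubgroup.subset_closure (Set.mem_image_of_mem a hi)
  -- More than `N` classes modulo `L` would multiply the weak bound for the indices in `L` up to `n²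
  -- / (4m)`; this is the role of `8192 = 32768 / 4` in `hN`.
  have hcosets : (sums (QuotientAddGroup.mk' L ∘ a) I).ncard ≤ N := by
    by_contra! hcon
    have h1 := ncard_sums_within_mul_le a I L
    have h2 : V ⊆ within a I L := fun i hi => mem_within.2 ⟨hVI hi, hVL i hi⟩
    have h3 : (V.card : ℝ) ≤ (within a I L).card := by exact_mod_cast Finset.card_le_card h2
    have h4 := hweak _ (within_subset a I L) (by linarith)
    have h5 : ((sums a (within a I L)).ncard : ℝ) * N ≤ (sums a I).ncard := by
      exact_mod_cast (Nat.mul_le_mul_left _ hcon.le).trans h1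
    have h6 : c * n ^ 2 / m * N ≤ (sums a I).ncard :=
      (mul_le_mul_of_nonneg_right h4 hN0).trans h5
    have h7 : n ^ 2 / 4 ≤ m * (c * n ^ 2 / m * N) := by
      have : (m : ℝ) * (c * n ^ 2 / m * N) = n ^ 2 * (N * ε ^ 4 / 32768) := by
        rw [hc]; field_simp
      rw [this, div_eq_mul_inv]
      apply mul_le_mul_of_nonneg_left _ (by positivity)
      linarith
    have h8 := mul_le_mul_of_nonneg_left h6 (by linarith : (0 : ℝ) ≤ m)
    linarith
  have hBL : (QuotientAddGroup.mk' L '' sums a U).ncard ≤ N := by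
    rw [image_sums]
    exact (Set.ncard_le_ncard (sums_mono _ hUI)).trans hcosets
  obtain ⟨x, hx, hxB⟩ := exists_large_inter_coset ⟨0, zero_mem_sums a U⟩ hBL
  set b := (sums a U ∩ (x +ᵥ (L : Set G))).ncard with hb
  set T : ℝ := c * n ^ 2 / m / (N + 1) with hT
  have hT0 : 0 < T := by positivity
  have hTb : T ≤ b := by
    rw [hT, div_le_iff₀ (by positivity)]
    have h1 := hweak U hUI (by linarith)
    have h2 : ((sums a U).ncard : ℝ) ≤ N * b := by exact_mod_cast hxB
    have h3 : (0 : ℝ) ≤ b := Nat.cast_nonneg b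
    linarith
  have hVn : (V.card : ℝ) ≤ n := by rw [hndef]; exact_mod_cast Finset.card_le_card hVI
  -- The deduction `ε²n` is the number of elements of `V` allowed inside a proper subgroup `K`. With
  -- more of them, the weak bound makes `|K|` exceed `n / m ≥ κ`.
  set κ : ℝ := (V.card - ε ^ 2 * n) / m with hκ
  have hκ0 : 0 < κ := by
    have : ε ^ 2 * n < ε * n := by
      apply mul_lt_mul_of_pos_right _ hn1
      nlinarith
    rw [hκ]
    exact div_pos (by linarith) (by linarith)
  have hκn : κ ≤ n / m := by
    rw [hκ]
    gcongr
    nlinarith [sq_nonneg ε]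
  have hκT : κ ≤ ε * T := by
    refine hκn.trans ?_
    have : ε * T = n / m * ((ε * (c * n)) / (N + 1)) := by rw [hT]; field_simp
    rw [this]
    apply le_mul_of_one_le_right (by positivity)
    rw [le_div_iff₀ (by positivity), one_mul]
    exact hcn
  have hκT' : κ ≤ T := hκT.trans (by nlinarith)
  obtain ⟨v, hv, hlam⟩ := exists_half_bound_le_shiftDefect (h.multiplicity.mono hVI) hκ0 hκT'
    (B := sums a U) (x := x) (by
      intro K hK
      by_cases hKV : ((within a V K).card : ℝ) ≤ ε ^ 2 * n
      · left
        have h1 : ((within a V K).card : ℝ) + (outside a V K).card = V.card := by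
          exact_mod_cast card_within_add_card_outside a V K
        have h2 : κ * m = V.card - ε ^ 2 * n := by rw [hκ]; field_simp
        rw [h2]; linarith
      · right
        have h1 := hweak _ ((within_subset a V K).trans hVI) (not_le.1 hKV).le
        have h2 : ((sums a (within a V K)).ncard : ℝ) ≤ Nat.card K := by
          exact_mod_cast Set.ncard_le_ncard (sums_within_subset a V K)
        refine hκn.trans (le_trans ?_ (h1.trans h2))
        have h3 : 1 ≤ c * n := by nlinarith [mul_pos hc0 hn1]
        calc n / m ≤ n / m * (c * n) := le_mul_of_one_le_right (by positivity) h3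
          _ = _ := by ring) hTb (by
      -- If `sums a U` nearly fills `x + L`, adding `sums a V` fills it, and the sums of `R` carry
      -- it to every coset of `L` in the group generated by the family, contradicting admissibility.
      by_contra! hcon
      have h1 := hweak V hVI (by linarith)
      have h2 : T ≤ c * n ^ 2 / m := by
        rw [hT]
        exact div_le_self (by positivity) (by linarith)
      have h3 : (Nat.card L : ℝ) < b + (sums a V).ncard := by linarith
      have h4 := coset_subset_add (L := L) (X := sums a U ∩ (x +ᵥ (L : Set G))) (Y := sums a V)
        Set.inter_subset_right (sums_subset hVL) (by exact_mod_cast h3)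
      have h5 : x +ᵥ (L : Set G) ⊆ sums a (I \ R) := by
        rw [← hUVI, sums_union a hUV]
        exact h4.trans (Set.add_subset_add_right Set.inter_subset_left)
      have hIL : ∀ i ∈ I, a i ∈ AddSubgroup.closure (a '' I) := fun i hi =>
        AddSubgroup.subset_closure (Set.mem_image_of_mem a hi)
      refine h.not_subset_sums hIL hI fun l hl => ?_
      have hxL : x ∈ AddSubgroup.closure (a '' I) := sums_subset (fun i hi => hIL i (hUI hi)) hx
      obtain ⟨r, hr, hrl⟩ := exists_mem_sums_sub_mem hRI hR hcosets (AddSubgroup.sub_mem _ hl hxL)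
      rw [← Finset.union_sdiff_of_subset hRI, sums_union a Finset.disjoint_sdiff]
      refine ⟨r, hr, x + (l - x - r), h5 ⟨_, hrl, rfl⟩, ?_⟩
      change r + (x + (l - x - r)) = l
      abel)
  refine ⟨v, hv, le_trans ?_ hlam⟩
  have h1 : κ / T ≤ ε := by rw [div_le_iff₀ hT0]; exact hκT
  have h2 : (1 - ε) * V.card / m ≤ κ := by
    rw [hκ]
    gcongr
    nlinarith
  have hV0 : (0 : ℝ) ≤ V.card := Nat.cast_nonneg _
  calc (1 - 2 * ε) * V.card / (2 * m) ≤ (1 - ε) * (1 - ε) * V.card / (2 * m) := by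
        gcongr
        nlinarith [sq_nonneg ε]
    _ = (1 - ε) * V.card / m / 2 * (1 - ε) := by field_simp
    _ ≤ κ / 2 * (1 - κ / T) := by
        gcongr
        linarith

theorem Admissible.bound_of_reserve (h : Admissible a I m)
    (hε : 0 < ε) (hε1 : ε ≤ 1 / 8) (hRI : R ⊆ I) (hRcard : (R.card : ℝ) ≤ ε * I.card)
    (hR : ∀ K : AddSubgroup G, (∀ i ∈ I, a i ∈ K) ∨ N ≤ (outside a R K).card)
    (hN : 8192 ≤ N * ε ^ 4) (hn : 32768 * (N + 1) ≤ ε ^ 5 * I.card) :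
    (1 / 4 - 2 * ε) * (I.card : ℝ) ^ 2 ≤ m * (sums a I).ncard := by
  classical
  have hn0 : (0 : ℝ) ≤ I.card := Nat.cast_nonneg _
  by_cases hsmall : (m : ℝ) * (sums a I).ncard < I.card ^ 2 / 4
  swap
  · nlinarith [sq_nonneg (I.card : ℝ)]
  set n : ℝ := (I.card : ℝ) with hndef
  have hN0 : (0 : ℝ) ≤ N := Nat.cast_nonneg N
  have hεn : 1 ≤ ε * n := by
    have h1 : ε ^ 5 * n ≤ ε * n := by
      apply mul_le_mul_of_nonneg_right _ hn0
      calc ε ^ 5 = ε * ε ^ 4 := by ring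
        _ ≤ ε * 1 := by gcongr; exact pow_le_one₀ hε.le (by linarith)
        _ = ε := mul_one ε
    linarith
  have hI : I.Nonempty := by
    rw [← Finset.card_pos]
    have : (0 : ℝ) < n := by nlinarith
    rw [hndef] at this; exact_mod_cast this
  have hm' : (1 : ℝ) ≤ m := by exact_mod_cast h.one_le hI
  -- Greedy steps need both `U` and `V` to have at least `εn` elements, so `u` indices are spent at
  -- the start and `u` are left at the end.
  set u := ⌈ε * n⌉₊ with hu
  have hu1 : ε * n ≤ u := Nat.le_ceil _
  have hu2 : (u : ℝ) ≤ 2 * (ε * n) := by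
    have := Nat.ceil_lt_add_one (show 0 ≤ ε * n by positivity)
    linarith
  have hI0 : ((I \ R).card : ℝ) = n - R.card := by
    rw [Finset.card_sdiff_of_subset hRI, Nat.cast_sub (Finset.card_le_card hRI)]
  have hule : 2 * u ≤ (I \ R).card := by
    have : (2 : ℝ) * u ≤ (I \ R).card := by rw [hI0]; nlinarith
    exact_mod_cast this
  set w := (I \ R).card - u with hw
  have hwu : u ≤ w := by omega
  have hwn : (w : ℝ) = n - R.card - u := by
    rw [hw, Nat.cast_sub (by omega), hI0]
  -- Step `j` finds `|V| = w - j`, and the sum of `w - j` over `j < s` is at least `sw - s² / 2`.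
  have main : ∀ s ≤ w - u, ∃ U ⊆ I \ R, U.card = u + s ∧
      (1 - 2 * ε) * ((s : ℝ) * w - s ^ 2 / 2) / (2 * m) ≤ (sums a U).ncard := by
    intro s hs
    induction s with
    | zero =>
      obtain ⟨U, hU, hc⟩ := Finset.exists_subset_card_eq (show u ≤ (I \ R).card by omega)
      exact ⟨U, hU, hc, by simp⟩
    | succ s ih =>
      obtain ⟨U, hU, hc, hs'⟩ := ih (Nat.le_of_succ_le hs)
      clear ih
      have hVc : ((I \ R) \ U).card = w - s := by
        rw [Finset.card_sdiff_of_subset hU]; omega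
      have hVc' : ((((I \ R) \ U).card : ℕ) : ℝ) = w - s := by
        rw [hVc, Nat.cast_sub (by omega)]
      have huV : (u : ℝ) ≤ ((I \ R) \ U).card := by
        have : u ≤ ((I \ R) \ U).card := by omega
        exact_mod_cast this
      have huU : (u : ℝ) ≤ U.card := by
        have : u ≤ U.card := by omega
        exact_mod_cast this
      obtain ⟨v, hv, hlam⟩ := h.exists_shiftDefect_of_reserve hε hε1 hRI hR hN hn hsmall
        (U := U) (V := (I \ R) \ U) Finset.disjoint_sdiff (Finset.union_sdiff_of_subset hU)
        (hu1.trans huU) (hu1.trans huV)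
      rw [Finset.mem_sdiff] at hv
      refine ⟨insert v U, Finset.insert_subset hv.1 hU, ?_, ?_⟩
      · rw [Finset.card_insert_of_notMem hv.2]; omega
      · rw [ncard_sums_insert a hv.2]
        push_cast
        refine le_trans ?_ (add_le_add hs' hlam)
        rw [hVc', ← add_div]
        gcongr
        rw [← mul_add]
        apply mul_le_mul_of_nonneg_left _ (by linarith)
        nlinarith
  obtain ⟨U, hU, -, hfin⟩ := main (w - u) le_rfl
  have h1 : ((sums a U).ncard : ℝ) ≤ (sums a I).ncard := by
    exact_mod_cast Set.ncard_le_ncard (sums_mono a (hU.trans Finset.sdiff_subset))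
  have h2 := hfin.trans h1
  rw [Nat.cast_sub hwu, div_le_iff₀ (by positivity)] at h2
  have h3 : ((w : ℝ) - u) * w - ((w : ℝ) - u) ^ 2 / 2 = ((w : ℝ) ^ 2 - u ^ 2) / 2 := by ring
  rw [h3] at h2
  have hw1 : (1 - 3 * ε) * n ≤ w := by rw [hwn]; nlinarith
  have h4 : ((1 - 3 * ε) * n) ^ 2 ≤ (w : ℝ) ^ 2 := by
    apply pow_le_pow_left₀ _ hw1
    apply mul_nonneg (by linarith) hn0
  have h5 : (u : ℝ) ^ 2 ≤ (2 * (ε * n)) ^ 2 := by gcongr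
  have h6 : (1 - 6 * ε) * n ^ 2 ≤ (w : ℝ) ^ 2 - u ^ 2 := by nlinarith [sq_nonneg (ε * n)]
  have h7 : (1 - 2 * ε) * ((1 - 6 * ε) * n ^ 2 / 2) ≤ (1 - 2 * ε) * (((w : ℝ) ^ 2 - u ^ 2) / 2) := by
    apply mul_le_mul_of_nonneg_left _ (by linarith)
    linarith
  nlinarith [mul_nonneg (sq_nonneg ε) (sq_nonneg n)]

end Reserve

theorem le_six_mul_sqrt_of_two_pow_le {k : ℕ} {n : ℝ} (hn : 0 < n) (h : (2 : ℝ) ^ k ≤ n ^ 2) :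
    (k : ℝ) ≤ 6 * √n := by
  have h1 := Real.log_le_log (by positivity) h
  rw [Real.log_pow, Real.log_pow] at h1
  have hs : 0 < √n := Real.sqrt_pos.2 hn
  have h2 := Real.log_le_sub_one_of_pos hs
  rw [Real.log_sqrt hn.le] at h2
  have h3 := Real.log_two_gt_d9
  have h4 : (0 : ℝ) ≤ k := Nat.cast_nonneg k
  push_cast at h1
  nlinarith

/-- The quadratic lower bound for admissible families. -/
theorem exists_forall_admissible_bound {ε : ℝ} (hε : 0 < ε) (hε1 : ε ≤ 1 / 8) :
    ∃ n₀ : ℝ, ∀ {G : Type*} [AddCommGroup G] [Finite G] {ι : Type*} (a : ι → G) (I : Finset ι)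
      (m : ℕ), Admissible a I m → n₀ ≤ I.card →
      (1 / 4 - 3 * ε) * (I.card : ℝ) ^ 2 ≤ m * (sums a I).ncard := by
  obtain ⟨N, hN⟩ := exists_nat_ge (8192 / ε ^ 4)
  rw [div_le_iff₀ (by positivity)] at hN
  -- The square ensures that `N` generating sets of size at most `6√n` fit within `εn / 15`. The
  -- last term serves the greedy construction on a subfamily of size at least `n / 2`.
  refine ⟨max 1 (max ((90 * N / ε) ^ 2) (2 * (32768 * (N + 1)) / ε ^ 5)), ?_⟩
  intro G _ _ ι a I m h hn
  rw [max_le_iff, max_le_iff] at hn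
  obtain ⟨hn1, hn2, hn3⟩ := hn
  set n : ℝ := (I.card : ℝ) with hndef
  have hN0 : (0 : ℝ) ≤ N := Nat.cast_nonneg N
  by_cases hsmall : (m : ℝ) * (sums a I).ncard < n ^ 2 / 4
  swap
  · nlinarith [sq_nonneg n]
  have hI : I.Nonempty := by
    rw [← Finset.card_pos]
    have : (0 : ℝ) < n := by linarith
    rw [hndef] at this; exact_mod_cast this
  have hm' : (1 : ℝ) ≤ m := by exact_mod_cast h.one_le hI
  have hsums : ((sums a I).ncard : ℝ) ≤ n ^ 2 := by
    have : (0 : ℝ) ≤ (sums a I).ncard := Nat.cast_nonneg _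
    nlinarith
  -- Fifteen halvings give the factor `2¹⁵ = 32768`, exactly the constant of the weak bound, so the
  -- second alternative contradicts `hsmall`.
  rcases exists_robust_subset a I (ρ := ε * n / 15) (by positivity) 15 with
    ⟨I', hI', hc, hr⟩ | ⟨I', hI', hc, hs⟩
  · have hc' : (1 - ε) * n ≤ I'.card := by
      push_cast at hc; linarith
    have hII : ((sums a I').ncard : ℝ) ≤ (sums a I).ncard := by
      exact_mod_cast Set.ncard_le_ncard (sums_mono a hI')
    have hsqrt : 90 * N / ε ≤ √n := Real.le_sqrt_of_sq_le hn2
    have hd : (N : ℝ) * (6 * √n) ≤ ε * n / 15 := by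
      rw [div_le_iff₀ hε] at hsqrt
      have h1 : √n * √n = n := Real.mul_self_sqrt (by linarith)
      have h2 := mul_le_mul_of_nonneg_right hsqrt (Real.sqrt_nonneg n)
      have h3 : √n * ε * √n = ε * n := by rw [← h1]; ring_nf; rw [Real.sq_sqrt (by positivity)]
      linarith
    obtain ⟨R, hRI, hRcard, hR⟩ := exists_reserve (d := 6 * √n)
      (fun k hk => le_six_mul_sqrt_of_two_pow_le (by linarith) (hk.trans (hII.trans hsums)))
      hr N hd
    have hlarge : 32768 * ((N : ℝ) + 1) ≤ ε ^ 5 * I'.card := by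
      rw [div_le_iff₀ (by positivity)] at hn3
      have h1 : n / 2 ≤ I'.card := by nlinarith
      have h2 : ε ^ 5 * (n / 2) ≤ ε ^ 5 * I'.card := by gcongr
      linarith
    have key := (h.mono hI').bound_of_reserve hε hε1 hRI
      (hRcard.trans (hd.trans (by nlinarith))) hR hN hlarge
    have h1 : ((1 - ε) * n) ^ 2 ≤ (I'.card : ℝ) ^ 2 := by
      apply pow_le_pow_left₀ _ hc'
      apply mul_nonneg <;> linarith
    have h2 : (1 / 4 - 2 * ε) * ((1 - ε) * n) ^ 2 ≤ (1 / 4 - 2 * ε) * (I'.card : ℝ) ^ 2 :=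
      mul_le_mul_of_nonneg_left h1 (by linarith)
    have h3 : (1 / 4 - 3 * ε) ≤ (1 / 4 - 2 * ε) * (1 - ε) ^ 2 := by
      nlinarith [sq_nonneg ε, mul_nonneg hε.le (sq_nonneg ε)]
    have h4 : (1 / 4 - 3 * ε) * n ^ 2 ≤ (1 / 4 - 2 * ε) * ((1 - ε) * n) ^ 2 := by
      rw [mul_pow, ← mul_assoc]
      exact mul_le_mul_of_nonneg_right h3 (sq_nonneg n)
    have h5 : (m : ℝ) * (sums a I').ncard ≤ m * (sums a I).ncard := by gcongr
    linarith
  · exfalso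
    have hc' : n / 2 ≤ I'.card := by
      push_cast at hc; nlinarith
    have h1 := (h.mono hI').sq_card_le
    have h2 : (32768 : ℝ) * (sums a I').ncard ≤ (sums a I).ncard := by
      norm_num at hs; exact_mod_cast hs
    have h3 : (n / 2) ^ 2 ≤ (I'.card : ℝ) ^ 2 := by gcongr
    nlinarith

/-! ### Passage to the quotient by the stabiliser, and the error function. -/

theorem coe_subsetSum_eq_sums [DecidableEq G] (A : Finset G) :
    (A.subsetSum : Set G) = sums id A := by
  ext g
  rw [Finset.mem_coe, Finset.mem_subsetSum_iff]
  rfl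

section Quotient

variable [Finite G] {A : Finset G} {H : AddSubgroup G}

theorem admissible_quotient (hH : H = AddAction.stabilizer G (sums id A)) :
    Admissible (QuotientAddGroup.mk' H) (outside id A H) (Nat.card H) where
  ne_zero g hg h0 := (mem_outside.1 hg).2 ((QuotientAddGroup.eq_zero_iff g).1 h0)
  multiplicity := by
    intro J _ c hc
    rcases J.eq_empty_or_nonempty with rfl | ⟨j, hj⟩
    · simp
    · rw [← Set.ncard_coe_finset]
      have hsub : (J : Set G) ⊆ j +ᵥ (H : Set G) := by
        intro x hx
        rw [Set.mem_vadd_set_iff_neg_vadd_mem]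
        exact QuotientAddGroup.eq.1 ((hc j hj).trans (hc x hx).symm)
      refine (Set.ncard_le_ncard hsub).trans ?_
      rw [Set.ncard_vadd_set]
      exact le_rfl
  -- If the members in `K` had all of `K` as sums, `K` would stabilise the sums in the quotient.
  -- Since `sums id A` is a union of `H`-cosets, lifts of elements of `K` would stabilise it, so
  -- they lie in `H` and `K` is trivial.
  incomplete := by
    classical
    intro K hK hs
    apply hK
    rw [eq_bot_iff]
    intro c hc
    obtain ⟨g, rfl⟩ := QuotientAddGroup.mk'_surjective H c
    refine (QuotientAddGroup.eq_zero_iff g).2 ?_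
    have hS : sums (QuotientAddGroup.mk' H) (outside id A H) = QuotientAddGroup.mk' H '' sums id A := by
      rw [image_sums, ← sums_quotient_outside id A H]; rfl
    have hKmem : ∀ k ∈ K, ∀ y ∈ sums (QuotientAddGroup.mk' H) (outside id A H),
        k + y ∈ sums (QuotientAddGroup.mk' H) (outside id A H) := by
      intro k hk y hy
      rw [← within_union_outside (QuotientAddGroup.mk' H) (outside id A H) K,
        sums_union _ (disjoint_within_outside _ _ K), hs] at hy ⊢
      obtain ⟨k', hk', z, hz, rfl⟩ := hy
      exact ⟨k + k', K.add_mem hk hk', z, hz, add_assoc _ _ _⟩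
    rw [hH]
    apply mem_stabilizer_of_vadd_subset
    rintro _ ⟨s, hs', rfl⟩
    have h1 := hKmem _ hc (QuotientAddGroup.mk' H s) (hS ▸ ⟨s, hs', rfl⟩)
    rw [hS, ← map_add] at h1
    obtain ⟨t, ht, hts⟩ := h1
    have h2 : -t + (g + s) ∈ H := QuotientAddGroup.eq.1 hts
    rw [hH] at h2
    have h3 := add_mem_of_mem_stabilizer h2 ht
    simpa [add_comm, add_assoc, add_left_comm] using h3

theorem card_mul_ncard_sums_quotient_le (hH : H = AddAction.stabilizer G (sums id A)) :
    Nat.card H * (sums (QuotientAddGroup.mk' H) (outside id A H)).ncard ≤ (sums id A).ncard := by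
  have h1 := ncard_mul_ncard_image_mk_le (K := H) (X := (H : Set G)) (Y := sums id A) le_rfl
  rw [image_sums, ← sums_quotient_outside] at h1
  refine h1.trans (Set.ncard_le_ncard ?_)
  rintro _ ⟨d, hd, s, hs, rfl⟩
  exact add_mem_of_mem_stabilizer (hH ▸ hd) hs

end Quotient

/-- The bound of the theorem with error term `δ`, for all sets with ratio at least `x`. -/
def BoundHolds.{u} (δ x : ℝ) : Prop :=
  ∀ (G : Type u) [AddCommGroup G] [Finite G] (A : Finset G) (H : AddSubgroup G),
    H = AddAction.stabilizer G (sums id A) →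
    x ≤ ((outside id A H).card : ℝ) / Nat.card H →
    (1 / 4 - δ) * ((outside id A H).card : ℝ) ^ 2 ≤ (sums id A).ncard

theorem boundHolds_quarter (x : ℝ) : BoundHolds (1 / 4) x := by
  intro G _ _ A H _ _
  simp

theorem exists_forall_boundHolds.{u} {δ : ℝ} (hδ : 0 < δ) :
    ∃ x₀ : ℝ, ∀ x ≥ x₀, BoundHolds.{u} δ x := by
  obtain ⟨n₀, hn₀⟩ := exists_forall_admissible_bound.{u, u} (ε := min (δ / 3) (1 / 8))
    (lt_min (by positivity) (by norm_num)) (min_le_right _ _)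
  refine ⟨n₀, fun x hx G _ _ A H hH hratio => ?_⟩
  set n : ℝ := ((outside id A H).card : ℝ) with hn
  have hcard : (1 : ℝ) ≤ Nat.card H := by exact_mod_cast Nat.card_pos (α := H)
  have hle : n₀ ≤ n := hx.le.trans (hratio.trans (div_le_self (Nat.cast_nonneg _) hcard))
  have h1 := hn₀ _ _ _ (admissible_quotient hH) hle
  have h2 : (Nat.card H : ℝ) * (sums (QuotientAddGroup.mk' H) (outside id A H)).ncard ≤
      (sums id A).ncard := by exact_mod_cast card_mul_ncard_sums_quotient_le hH
  refine le_trans ?_ (h1.trans h2)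
  apply mul_le_mul_of_nonneg_right _ (sq_nonneg n)
  linarith [min_le_left (δ / 3) (1 / 8)]

end SubsetSums

open SubsetSums in
theorem theorem3 :
    ∃ ε : ℝ → ℝ, Tendsto ε atTop (𝓝 0) ∧
      ∀ (G : Type*) [AddCommGroup G] [Finite G] [DecidableEq G] (A : Finset G)
        (H : AddSubgroup G), H = AddAction.stabilizer G (A.subsetSum : Set G) →
        (1 / 4 - ε ((((A : Set G) \ (H : Set G)).ncard : ℝ) / (Nat.card H : ℝ))) *
            (((A : Set G) \ (H : Set G)).ncard : ℝ) ^ 2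
          ≤ (A.subsetSum.card : ℝ) := by
  -- The error is the best admissible `δ` at ratio `x`, uniformly over all groups. The set is
  -- nonempty because `1 / 4` always belongs to it, and the infimum inherits the bound since `1 / 4
  -- - |Σ(A)| / n²` is a lower bound for it.
  refine ⟨fun x => sInf {δ : ℝ | 0 ≤ δ ∧ BoundHolds δ x}, ?_, ?_⟩
  · have hbdd : ∀ x, BddBelow {δ : ℝ | 0 ≤ δ ∧ BoundHolds δ x} := fun x => ⟨0, fun δ hδ => hδ.1⟩
    rw [Metric.tendsto_atTop]
    intro δ hδ
    obtain ⟨x₀, hx₀⟩ := exists_forall_boundHolds (half_pos hδ)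
    refine ⟨x₀, fun x hx => ?_⟩
    have h1 : sInf {δ : ℝ | 0 ≤ δ ∧ BoundHolds δ x} ≤ δ / 2 :=
      csInf_le (hbdd x) ⟨(half_pos hδ).le, hx₀ x hx⟩
    have h2 : 0 ≤ sInf {δ : ℝ | 0 ≤ δ ∧ BoundHolds δ x} := Real.sInf_nonneg fun δ hδ => hδ.1
    rw [Real.dist_eq, sub_zero, abs_of_nonneg h2]
    linarith
  · intro G _ _ _ A H hH
    rw [coe_subsetSum_eq_sums] at hH
    have hcard : ((A : Set G) \ (H : Set G)).ncard = (outside id A H).card := by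
      rw [← Set.ncard_coe_finset]
      congr 1
      ext g
      simp [mem_outside]
    have hsums : A.subsetSum.card = (sums id A).ncard := by
      rw [← Set.ncard_coe_finset, coe_subsetSum_eq_sums]
    rw [hcard, hsums]
    set n : ℝ := ((outside id A H).card : ℝ) with hn
    rcases (show (0 : ℝ) ≤ n from Nat.cast_nonneg _).eq_or_lt with h0 | h0
    · rw [← h0]; simp
    · have hsq : 0 < n ^ 2 := by positivity
      have h1 : 1 / 4 - ((sums id A).ncard : ℝ) / n ^ 2 ≤
          sInf {δ : ℝ | 0 ≤ δ ∧ BoundHolds δ (n / Nat.card H)} := by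
        refine le_csInf ⟨1 / 4, by norm_num, boundHolds_quarter _⟩ fun δ hδ => ?_
        have h2 := hδ.2 G A H hH le_rfl
        rw [← le_div_iff₀ hsq] at h2
        linarith
      rw [← le_div_iff₀ hsq]
      linarith
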